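/- **Conventions.** Rings are associative and unital. For a ring $A$, an $A$-coring is an $(A,A)$-bimodule $\mathfrak C$ with $(A,A)$-bimodule maps $\Delta:\mathfrak C\to\mathfrak C\otimes_A\mathfrak C$ (coassociative) and $\varepsilon:\mathfrak C\to A$ (a counit for $\Delta$). It is a *Frobenius coring* if the forgetful functor from right $\mathfrak C$-comodules to right $A$-modules is a Frobenius functor, i.e. some functor is both a left and a right adjoint of it. A *Frobenius system* of $\mathfrak C$ is a pair $(\pi,e)$ of a $(\mathfrak C,\mathfrak C)$-bicomodule map $\pi:\mathfrak C\otimes_A\mathfrak C\to\mathfrak C$ (coactions $\Delta\otimes I$ and $I\otimes\Delta$ on $\mathfrak C\otimes_A\mathfrak C$) and an element $e\in\mathfrak C$ with $ae=ea$ for all $a\in A$, such that $\pi(c\otimes e)=c=\pi(e\otimes c)$ for all $c\in\mathfrak C$; put $\gamma=\varepsilon\circ\pi$ and $\Theta:A\to\mathfrak C$, $a\mapsto ae$. A ring map $A\to B$ is a *Frobenius extension* if $B$ is a finitely generated projective right $A$-module and $B\cong\mathrm{Hom}_A(B,A)$ (right $A$-linear maps) as $(A,B)$-bimodules. **Theorem.**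 Let $\mathfrak C$ be a Frobenius $A$-coring, and put $\mathfrak C^0=A$ and $\mathfrak C^k=\mathfrak C^{\otimes_A k}$ for $k\ge 1$. Then $\mathfrak C$ has a Frobenius system, and for every Frobenius system $(\pi,e)$ of $\mathfrak C$ the following holds. The abelian groups $\mathfrak C^k$ carry ring structures for which $\mathfrak C^0$ is the ring $A$, $$cd=\pi(c\otimes d)\ \text{ in }\mathfrak C^1,\qquad (c\otimes c')(d\otimes d')=c\otimes\gamma(c'\otimes d)\,d'\ \text{ in }\mathfrak C^2,$$ $$(c\otimes x\otimes c')(d\otimes y\otimes d')=c\otimes x\,\bigl(\gamma(c'\otimes d)\,y\bigr)\otimes d'\ \text{ in }\mathfrak C^{k+2}\qquad(k\ge 1,\ x,y\in\mathfrak C^{k}),$$ and with these the maps $$\mathfrak C^0\xrightarrow{\ \Theta\ }\mathfrak C^1\xrightarrow{\ \Delta\ }\mathfrak C^2\xrightarrow{\ I\otimes\Theta\otimes I\ }\mathfrak C^3\xrightarrow{\ I\otimes\Delta\otimes I\ }\mathfrak C^4\longrightarrow\cdots$$ (that is, $I^{\otimes m}\otimes\Theta\otimes I^{\otimes m}:\mathfrak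 C^{2m}\to\mathfrak C^{2m+1}$ and $I^{\otimes m}\otimes\Delta\otimes I^{\otimes m}:\mathfrak C^{2m+1}\to\mathfrak C^{2m+2}$) are ring maps. For every $k\ge1$: 1. $\mathfrak C^{k-1}\to\mathfrak C^{k}$ is a Frobenius extension; 2. $\mathfrak C^{k}$, with the $(\mathfrak C^{k-1},\mathfrak C^{k-1})$-bimodule structure given by this ring map, is a Frobenius $\mathfrak C^{k-1}$-coring. Its counit $\mathfrak C^k\to\mathfrak C^{k-1}$ is $I^{\otimes m}\otimes\varepsilon\otimes I^{\otimes m}$ if $k=2m+1$ and $I^{\otimes m}\otimes\pi\otimes I^{\otimes m}$ if $k=2m+2$, and the multiplication of $\mathfrak C^k$ together with the unit of $\mathfrak C^k$ is a Frobenius system for it. For $k=1$ it is the given $A$-coring $\mathfrak C$. -/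

import Mathlib

open CategoryTheory MulOpposite

universe u

namespace CoringTower

/-! ## Bimodules over a noncommutative ring

A right `A`-module is a `Module Aᵐᵒᵖ M`, with `m · a` written `op a • m`. An `(A, A)`-bimodule has
`[Module A M] [Module Aᵐᵒᵖ M] [SMulCommClass A Aᵐᵒᵖ M]`. -/

/-- Homomorphisms of `(A, A)`-bimodules. -/
structure BimodHom (A : Type u) [Ring A] (M N : Type u)
    [AddCommGroup M] [Module A M] [Module Aᵐᵒᵖ M]
    [AddCommGroup N] [Module A N] [Module Aᵐᵒᵖ N] extends M →+ N where
  map_smul' : ∀ (a : A) (m : M), toFun (a • m) = a • toFun m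
  map_op_smul' : ∀ (a : A) (m : M), toFun (op a • m) = op a • toFun m

namespace BimodHom

variable {A : Type u} [Ring A] {M N P : Type u}
  [AddCommGroup M] [Module A M] [Module Aᵐᵒᵖ M]
  [AddCommGroup N] [Module A N] [Module Aᵐᵒᵖ N]
  [AddCommGroup P] [Module A P] [Module Aᵐᵒᵖ P]

instance : FunLike (BimodHom A M N) M N where
  coe f := f.toFun
  coe_injective f g h := by
    cases f
    cases g
    congr
    exact DFunLike.coe_injective h

instance : AddMonoidHomClass (BimodHom A M N) M N where
  map_add f := f.map_add'
  map_zero f := f.map_zero'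

/-- The underlying homomorphism of left modules. -/
def left (f : BimodHom A M N) : M →ₗ[A] N where
  toFun := f
  map_add' := f.map_add'
  map_smul' := f.map_smul'

/-- The underlying homomorphism of right modules. -/
def right (f : BimodHom A M N) : M →ₗ[Aᵐᵒᵖ] N where
  toFun := f
  map_add' := f.map_add'
  map_smul' a m := f.map_op_smul' a.unop m

@[simp] theorem left_apply (f : BimodHom A M N) (m : M) : f.left m = f m := rfl

@[simp] theorem right_apply (f : BimodHom A M N) (m : M) : f.right m = f m := rfl

variable (A M) in
/-- The identity. -/
def id : BimodHom A M M where
  toAddMonoidHom := AddMonoidHom.id M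
  map_smul' _ _ := rfl
  map_op_smul' _ _ := rfl

/-- Composition, `g` after `f`. -/
def comp (g : BimodHom A N P) (f : BimodHom A M N) : BimodHom A M P where
  toAddMonoidHom := g.toAddMonoidHom.comp f.toAddMonoidHom
  map_smul' a m := (congrArg g (f.map_smul' a m)).trans (g.map_smul' a _)
  map_op_smul' a m := (congrArg g (f.map_op_smul' a m)).trans (g.map_op_smul' a _)

end BimodHom

/-! ## The tensor product over a noncommutative ring -/

section Tensor

variable (A : Type u) [Ring A]

open scoped TensorProduct in
/-- The subgroup of `M ⊗_ℤ N` generated by the elements `m a ⊗ n - m ⊗ a n`. -/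
def balancing (M N : Type u) [AddCommGroup M] [Module Aᵐᵒᵖ M] [AddCommGroup N] [Module A N] :
    AddSubgroup (M ⊗[ℤ] N) :=
  AddSubgroup.closure
    {t | ∃ (m : M) (a : A) (n : N), t = (op a • m) ⊗ₜ[ℤ] n - m ⊗ₜ[ℤ] (a • n)}

open scoped TensorProduct in
/-- The tensor product `M ⊗_A N` of a right `A`-module `M` and a left `A`-module `N`. -/
def Tensor (M N : Type u) [AddCommGroup M] [Module Aᵐᵒᵖ M] [AddCommGroup N] [Module A N] :
    Type u :=
  (M ⊗[ℤ] N) ⧸ balancing A M N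

namespace Tensor

variable {M N P M' N' : Type u}
  [AddCommGroup M] [Module Aᵐᵒᵖ M] [AddCommGroup N] [Module A N]
  [AddCommGroup M'] [Module Aᵐᵒᵖ M'] [AddCommGroup N'] [Module A N']

instance : AddCommGroup (Tensor A M N) :=
  inferInstanceAs (AddCommGroup (_ ⧸ balancing A M N))

/-- The pure tensor `m ⊗ n`. -/
def tmul (m : M) (n : N) : Tensor A M N :=
  QuotientAddGroup.mk' (balancing A M N) (TensorProduct.tmul ℤ m n)

theorem add_tmul (m m' : M) (n : N) : tmul A (m + m') n = tmul A m n + tmul A m' n := by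
  unfold tmul
  rw [TensorProduct.add_tmul]
  exact map_add (QuotientAddGroup.mk' (balancing A M N)) _ _

theorem tmul_add (m : M) (n n' : N) : tmul A m (n + n') = tmul A m n + tmul A m n' := by
  unfold tmul
  rw [TensorProduct.tmul_add]
  exact map_add (QuotientAddGroup.mk' (balancing A M N)) _ _

theorem smul_tmul (m : M) (a : A) (n : N) : tmul A (op a • m) n = tmul A m (a • n) := by
  refine sub_eq_zero.mp ((map_sub (QuotientAddGroup.mk' (balancing A M N)) _ _).symm.trans ?_)
  exact (QuotientAddGroup.eq_zero_iff _).2 (AddSubgroup.subset_closure ⟨m, a, n, rfl⟩)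

/-- `tmul` as a biadditive map. -/
def mk : M →+ N →+ Tensor A M N :=
  AddMonoidHom.mk' (fun m => AddMonoidHom.mk' (tmul A m) (tmul_add A m))
    (fun m m' => AddMonoidHom.ext (add_tmul A m m'))

@[simp] theorem mk_apply (m : M) (n : N) : mk A m n = tmul A m n := rfl

section lift

variable [AddCommGroup P]

/-- The homomorphism induced by an `A`-balanced biadditive map. -/
def lift (f : M →+ N →+ P) (hf : ∀ m (a : A) n, f (op a • m) n = f m (a • n)) :
    Tensor A M N →+ P :=
  QuotientAddGroup.lift (balancing A M N)
    (TensorProduct.liftAddHom f (fun r m n => by simp))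
    ((AddSubgroup.closure_le _).2 (by
      rintro _ ⟨m, a, n, rfl⟩
      simp [hf]))

@[simp] theorem lift_tmul (f : M →+ N →+ P) (hf : ∀ m (a : A) n, f (op a • m) n = f m (a • n))
    (m : M) (n : N) : lift A f hf (tmul A m n) = f m n := rfl

variable {A} in
theorem induction_on {p : Tensor A M N → Prop} (t : Tensor A M N)
    (h : ∀ m n, p (tmul A m n)) (hadd : ∀ x y, p x → p y → p (x + y)) : p t := by
  obtain ⟨t, rfl⟩ := QuotientAddGroup.mk'_surjective _ t
  induction t using TensorProduct.induction_on with
  | zero => simpa [tmul] using h 0 0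
  | tmul m n => exact h m n
  | add x y hx hy => rw [map_add]; exact hadd _ _ hx hy

variable {A} in
theorem addHom_ext {f g : Tensor A M N →+ P} (h : ∀ m n, f (tmul A m n) = g (tmul A m n)) :
    f = g := by
  ext t
  induction t using induction_on with
  | h m n => exact h m n
  | hadd x y hx hy => rw [map_add, map_add, hx, hy]

end lift

variable {A}

/-- The map `f ⊗ g`, for `f` right linear and `g` left linear. -/
def map (f : M →ₗ[Aᵐᵒᵖ] M') (g : N →ₗ[A] N') : Tensor A M N →+ Tensor A M' N' :=
  lift A (((mk A).comp f.toAddMonoidHom).compl₂ g.toAddMonoidHom)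
    (fun m a n => by simp [smul_tmul])

@[simp] theorem map_tmul (f : M →ₗ[Aᵐᵒᵖ] M') (g : N →ₗ[A] N') (m : M) (n : N) :
    map f g (tmul A m n) = tmul A (f m) (g n) := rfl

section leftModule

variable [Module A M] [SMulCommClass A Aᵐᵒᵖ M] [Module A M'] [SMulCommClass A Aᵐᵒᵖ M']

variable (M) in
/-- Left multiplication by `a`, as a right linear map. -/
def leftMul (a : A) : M →ₗ[Aᵐᵒᵖ] M where
  toFun m := a • m
  map_add' := smul_add a
  map_smul' b m := smul_comm a b m

instance : SMul A (Tensor A M N) := ⟨fun a t => map (leftMul M a) LinearMap.id t⟩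

@[simp] theorem smul_tmul' (a : A) (m : M) (n : N) : a • tmul A m n = tmul A (a • m) n := rfl

theorem smul_add_aux (a : A) (x y : Tensor A M N) : a • (x + y) = a • x + a • y :=
  map_add (map (leftMul M a) LinearMap.id) x y

/-- The left module structure `a (m ⊗ n) = a m ⊗ n`. -/
instance : Module A (Tensor A M N) where
  one_smul t := by
    induction t using induction_on with
    | h m n => simp
    | hadd x y hx hy => rw [smul_add_aux, hx, hy]
  mul_smul a b t := by
    induction t using induction_on with
    | h m n => simp [mul_smul]
    | hadd x y hx hy => simp only [smul_add_aux, hx, hy]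
  smul_zero a := map_zero (map (leftMul M a) LinearMap.id)
  smul_add := smul_add_aux
  add_smul a b t := by
    induction t using induction_on with
    | h m n => simp [add_smul, add_tmul]
    | hadd x y hx hy => rw [smul_add_aux, smul_add_aux, smul_add_aux, hx, hy]; abel
  zero_smul t := by
    induction t using induction_on with
    | h m n =>
      rw [smul_tmul', zero_smul]
      exact map_zero (AddMonoidHom.flip (mk A) n)
    | hadd x y hx hy => rw [smul_add_aux, hx, hy, add_zero]

end leftModule

section rightModule

variable [Module Aᵐᵒᵖ N] [SMulCommClass A Aᵐᵒᵖ N] [Module Aᵐᵒᵖ N'] [SMulCommClass A Aᵐᵒᵖ N']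

variable (N) in
/-- Right multiplication by `a`, as a left linear map. -/
def rightMul (a : Aᵐᵒᵖ) : N →ₗ[A] N where
  toFun n := a • n
  map_add' := smul_add a
  map_smul' b n := (smul_comm b a n).symm

instance : SMul Aᵐᵒᵖ (Tensor A M N) := ⟨fun a t => map LinearMap.id (rightMul N a) t⟩

@[simp] theorem op_smul_tmul (a : Aᵐᵒᵖ) (m : M) (n : N) :
    a • tmul A m n = tmul A m (a • n) := rfl

theorem op_smul_add_aux (a : Aᵐᵒᵖ) (x y : Tensor A M N) : a • (x + y) = a • x + a • y :=
  map_add (map LinearMap.id (rightMul N a)) x y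

/-- The right module structure `(m ⊗ n) a = m ⊗ n a`. -/
instance : Module Aᵐᵒᵖ (Tensor A M N) where
  one_smul t := by
    induction t using induction_on with
    | h m n => simp
    | hadd x y hx hy => rw [op_smul_add_aux, hx, hy]
  mul_smul a b t := by
    induction t using induction_on with
    | h m n => simp [mul_smul]
    | hadd x y hx hy => simp only [op_smul_add_aux, hx, hy]
  smul_zero a := map_zero (map LinearMap.id (rightMul N a))
  smul_add := op_smul_add_aux
  add_smul a b t := by
    induction t using induction_on with
    | h m n => simp [add_smul, tmul_add]
    | hadd x y hx hy => rw [op_smul_add_aux, op_smul_add_aux, op_smul_add_aux, hx, hy]; abel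
  zero_smul t := by
    induction t using induction_on with
    | h m n =>
      rw [op_smul_tmul, zero_smul]
      exact map_zero (mk A m)
    | hadd x y hx hy => rw [op_smul_add_aux, hx, hy, add_zero]

end rightModule

instance [Module A M] [SMulCommClass A Aᵐᵒᵖ M] [Module Aᵐᵒᵖ N] [SMulCommClass A Aᵐᵒᵖ N] :
    SMulCommClass A Aᵐᵒᵖ (Tensor A M N) where
  smul_comm a b t := by
    induction t using induction_on with
    | h m n => simp
    | hadd x y hx hy => simp only [smul_add, hx, hy]

section assoc

variable {L : Type u} [AddCommGroup L] [Module A L] [Module Aᵐᵒᵖ L] [SMulCommClass A Aᵐᵒᵖ L]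

variable (M N)

/-- The map `(m ⊗ l) ⊗ n ↦ m ⊗ (l ⊗ n)`. -/
def assocHom : Tensor A (Tensor A M L) N →+ Tensor A M (Tensor A L N) :=
  lift A
    (lift A
      (AddMonoidHom.mk' (fun m => ((mk A m).compHom).comp (mk A)) (by
        intro m m'
        ext l n
        simp))
      (by
        intro m a l
        ext n
        simp [smul_tmul]))
    (by
      intro t a n
      induction t using induction_on with
      | h m l => simp [smul_tmul]
      | hadd x y hx hy => simp only [smul_add, map_add, AddMonoidHom.add_apply, hx, hy])

/-- The map `m ⊗ (l ⊗ n) ↦ (m ⊗ l) ⊗ n`. -/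
def assocInv : Tensor A M (Tensor A L N) →+ Tensor A (Tensor A M L) N :=
  lift A
    (AddMonoidHom.mk'
      (fun m => lift A ((mk A).comp (mk A m : L →+ Tensor A M L))
        (by
          intro l a n
          simp [← smul_tmul]))
      (by
        intro m m'
        refine addHom_ext (fun l n => ?_)
        change tmul A (tmul A (m + m') l) n = tmul A (tmul A m l) n + tmul A (tmul A m' l) n
        rw [add_tmul, add_tmul]))
    (by
      intro m a t
      induction t using induction_on with
      | h l n =>
        change tmul A (tmul A (op a • m) l) n = tmul A (tmul A m (a • l)) n
        rw [smul_tmul]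
      | hadd x y hx hy => simp only [smul_add, map_add, hx, hy])

/-- The associativity isomorphism `(M ⊗ L) ⊗ N ≃ M ⊗ (L ⊗ N)`. -/
def assoc : Tensor A (Tensor A M L) N ≃+ Tensor A M (Tensor A L N) :=
  AddMonoidHom.toAddEquiv (assocHom M N) (assocInv M N)
    (by
      refine addHom_ext (fun t n => ?_)
      induction t using induction_on with
      | h m l => rfl
      | hadd x y hx hy => rw [add_tmul, map_add, map_add, hx, hy])
    (by
      refine addHom_ext (fun m t => ?_)
      induction t using induction_on with
      | h l n => rfl
      | hadd x y hx hy => rw [tmul_add, map_add, map_add, hx, hy])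

@[simp] theorem assoc_tmul (m : M) (l : L) (n : N) :
    assoc M N (tmul A (tmul A m l) n) = tmul A m (tmul A l n) := rfl

@[simp] theorem assoc_symm_tmul (m : M) (l : L) (n : N) :
    (assoc M N).symm (tmul A m (tmul A l n)) = tmul A (tmul A m l) n := rfl

end assoc

variable (A) in
/-- The canonical map `A ⊗_A N → N`, `a ⊗ n ↦ a n`. -/
def lid (N : Type u) [AddCommGroup N] [Module A N] : Tensor A A N →+ N :=
  lift A (smulAddHom A N) (fun m a n => by simp [mul_smul])

variable (A) in
/-- The canonical map `M ⊗_A A → M`, `m ⊗ a ↦ m a`. -/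
def rid (M : Type u) [AddCommGroup M] [Module Aᵐᵒᵖ M] : Tensor A M A →+ M :=
  lift A (AddMonoidHom.mk' (fun m => AddMonoidHom.mk' (fun a : A => op a • m)
      (fun a b => by rw [MulOpposite.op_add, add_smul])) (fun m m' => by ext a; simp))
    (fun m a n => by simp [mul_smul])

@[simp] theorem lid_tmul (a : A) (n : N) : lid A N (tmul A a n) = a • n := rfl

@[simp] theorem rid_tmul (m : M) (a : A) : rid A M (tmul A m a) = op a • m := rfl

end Tensor

end Tensor

namespace BimodHom

open Tensor

variable {A : Type u} [Ring A] {M N M' N' : Type u}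
  [AddCommGroup M] [Module A M] [Module Aᵐᵒᵖ M] [SMulCommClass A Aᵐᵒᵖ M]
  [AddCommGroup N] [Module A N] [Module Aᵐᵒᵖ N] [SMulCommClass A Aᵐᵒᵖ N]
  [AddCommGroup M'] [Module A M'] [Module Aᵐᵒᵖ M'] [SMulCommClass A Aᵐᵒᵖ M']
  [AddCommGroup N'] [Module A N'] [Module Aᵐᵒᵖ N'] [SMulCommClass A Aᵐᵒᵖ N']

/-- The tensor product `f ⊗ g` of two bimodule maps. -/
def tensor (f : BimodHom A M M') (g : BimodHom A N N') :
    BimodHom A (Tensor A M N) (Tensor A M' N') where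
  toAddMonoidHom := Tensor.map f.right g.left
  map_smul' a t := by
    change Tensor.map f.right g.left (a • t) = a • Tensor.map f.right g.left t
    induction t using Tensor.induction_on with
    | h m n => exact congrArg (fun z => tmul A z (g n)) (f.map_smul' a m)
    | hadd x y hx hy => simp only [smul_add, map_add, hx, hy]
  map_op_smul' a t := by
    change Tensor.map f.right g.left (op a • t) = op a • Tensor.map f.right g.left t
    induction t using Tensor.induction_on with
    | h m n => exact congrArg (tmul A (f m)) (g.map_op_smul' a n)
    | hadd x y hx hy => simp only [smul_add, map_add, hx, hy]

@[simp] theorem tensor_tmul (f : BimodHom A M M') (g : BimodHom A N N') (m : M) (n : N) :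
    tensor f g (tmul A m n) = tmul A (f m) (g n) := rfl

variable (A N) in
/-- The canonical isomorphism `A ⊗_A N → N`, `a ⊗ n ↦ a n`. -/
def lid : BimodHom A (Tensor A A N) N where
  toAddMonoidHom := Tensor.lid A N
  map_smul' a t := by
    change Tensor.lid A N (a • t) = a • Tensor.lid A N t
    induction t using Tensor.induction_on with
    | h m n => simp [mul_smul]
    | hadd x y hx hy => simp only [smul_add, map_add, hx, hy]
  map_op_smul' a t := by
    change Tensor.lid A N (op a • t) = op a • Tensor.lid A N t
    induction t using Tensor.induction_on with
    | h m n => simp [smul_comm]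
    | hadd x y hx hy => simp only [smul_add, map_add, hx, hy]

variable (A N) in
/-- The inverse `N → A ⊗_A N`, `n ↦ 1 ⊗ n`, of `lid`. -/
def lidInv : BimodHom A N (Tensor A A N) where
  toAddMonoidHom := Tensor.mk A 1
  map_smul' a n := by
    change tmul A 1 (a • n) = a • tmul A 1 n
    rw [← smul_tmul]
    simp
  map_op_smul' a n := rfl

end BimodHom

/-! ## Corings, comodules and Frobenius corings -/

open Tensor

/-- An `A`-coring structure on the `(A, A)`-bimodule `C`. -/
structure Coring (A C : Type u) [Ring A] [AddCommGroup C] [Module A C] [Module Aᵐᵒᵖ C]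
    [SMulCommClass A Aᵐᵒᵖ C] where
  /-- the coproduct -/
  comul : BimodHom A C (Tensor A C C)
  /-- the counit -/
  counit : BimodHom A C A
  coassoc : ∀ c, Tensor.map LinearMap.id comul.left (comul c) =
    Tensor.assoc C C (Tensor.map comul.right LinearMap.id (comul c))
  rid_counit : ∀ c, Tensor.rid A C (Tensor.map LinearMap.id counit.left (comul c)) = c
  lid_counit : ∀ c, Tensor.lid A C (Tensor.map counit.right LinearMap.id (comul c)) = c

/-- A functor is a Frobenius functor if some functor is both a left and a right adjoint of it. -/
def IsFrobeniusFunctor {D E : Type*} [Category D] [Category E] (F : D ⥤ E) : Prop :=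
  ∃ G : E ⥤ D, Nonempty (G ⊣ F) ∧ Nonempty (F ⊣ G)

namespace Coring

variable {A C : Type u} [Ring A] [AddCommGroup C] [Module A C] [Module Aᵐᵒᵖ C]
  [SMulCommClass A Aᵐᵒᵖ C]

/-- Right comodules of a coring. -/
structure RightComodule (𝒞 : Coring A C) where
  carrier : Type u
  [addCommGroup : AddCommGroup carrier]
  [module : Module Aᵐᵒᵖ carrier]
  /-- the coaction -/
  coact : carrier →ₗ[Aᵐᵒᵖ] Tensor A carrier C
  coassoc : ∀ m, Tensor.map LinearMap.id 𝒞.comul.left (coact m) =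
    Tensor.assoc carrier C (Tensor.map coact LinearMap.id (coact m))
  counit : ∀ m, Tensor.rid A carrier (Tensor.map LinearMap.id 𝒞.counit.left (coact m)) = m

attribute [instance] RightComodule.addCommGroup RightComodule.module

/-- Morphisms of right comodules: right linear maps which commute with the coactions. -/
@[ext] structure RightComodule.Hom {𝒞 : Coring A C} (M N : 𝒞.RightComodule) where
  toLin : M.carrier →ₗ[Aᵐᵒᵖ] N.carrier
  comm : ∀ m, N.coact (toLin m) = Tensor.map toLin LinearMap.id (M.coact m)

/-- The category of right comodules. -/
instance (𝒞 : Coring A C) : Category 𝒞.RightComodule where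
  Hom M N := RightComodule.Hom M N
  id M := ⟨LinearMap.id, fun m => by
    have h : Tensor.map (LinearMap.id : M.carrier →ₗ[Aᵐᵒᵖ] M.carrier)
        (LinearMap.id : C →ₗ[A] C) = AddMonoidHom.id _ := addHom_ext (fun _ _ => rfl)
    rw [h]; rfl⟩
  comp {M N P} f g := ⟨g.toLin.comp f.toLin, fun m => by
    have h : Tensor.map (g.toLin.comp f.toLin) (LinearMap.id : C →ₗ[A] C) =
        (Tensor.map g.toLin LinearMap.id).comp (Tensor.map f.toLin LinearMap.id) :=
      addHom_ext (fun _ _ => rfl)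
    rw [h, AddMonoidHom.comp_apply, ← f.comm, ← g.comm]; rfl⟩

/-- The forgetful functor from right comodules to right `A`-modules. -/
def forget (𝒞 : Coring A C) : 𝒞.RightComodule ⥤ ModuleCat.{u} Aᵐᵒᵖ where
  obj M := ModuleCat.of Aᵐᵒᵖ M.carrier
  map f := ModuleCat.ofHom f.toLin

/-- A coring is Frobenius if the forgetful functor from its right comodules to right
`A`-modules is a Frobenius functor. -/
def IsFrobenius (𝒞 : Coring A C) : Prop := IsFrobeniusFunctor 𝒞.forget

/-- A Frobenius system `(π, e)` of a coring: an invariant element `e` and a bicomodule map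
`π : C ⊗_A C → C`, where `C ⊗_A C` has the left coaction `Δ ⊗ I` and the right coaction `I ⊗ Δ`,
such that `π (c ⊗ e) = c = π (e ⊗ c)`. -/
structure FrobeniusSystem (𝒞 : Coring A C) where
  π : BimodHom A (Tensor A C C) C
  e : C
  invariant : ∀ a : A, a • e = op a • e
  left_colinear : ∀ t, 𝒞.comul (π t) =
    Tensor.map LinearMap.id π.left (Tensor.assoc C C (Tensor.map 𝒞.comul.right LinearMap.id t))
  right_colinear : ∀ t, 𝒞.comul (π t) =
    Tensor.map π.right LinearMap.id
      ((Tensor.assoc C C).symm (Tensor.map LinearMap.id 𝒞.comul.left t))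
  π_tmul_e : ∀ c, π (tmul A c e) = c
  π_e_tmul : ∀ c, π (tmul A e c) = c

/-- The pair of isomorphisms `α : A → A'` and `φ : C → C'` identifies the `A`-coring `C` with the
`A'`-coring `C'`. -/
structure IsIsoOver {A' C' : Type u} [Ring A'] [AddCommGroup C'] [Module A' C']
    [Module A'ᵐᵒᵖ C'] [SMulCommClass A' A'ᵐᵒᵖ C'] (𝒞 : Coring A C) (𝒞' : Coring A' C')
    (α : A ≃+* A') (φ : C ≃+ C') : Prop where
  map_smul : ∀ a c, φ (a • c) = α a • φ c
  map_op_smul : ∀ (a : A) c, φ (op a • c) = op (α a) • φ c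
  counit : ∀ c, 𝒞'.counit (φ c) = α (𝒞.counit c)
  comul : ∃ j : Tensor A C C →+ Tensor A' C' C',
    (∀ c d, j (tmul A c d) = tmul A' (φ c) (φ d)) ∧ ∀ c, 𝒞'.comul (φ c) = j (𝒞.comul c)

end Coring

/-! ## Ring extensions -/

section Extension

variable {A B : Type u} [Ring A] [Ring B]

/-- The ring `B` viewed as an `(A, A)`-bimodule along a ring map `f : A → B`. -/
def Along (_ : A →+* B) : Type u := B

instance (f : A →+* B) : Ring (Along f) := inferInstanceAs (Ring B)

instance (f : A →+* B) : Module A (Along f) := Module.compHom B f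

instance (f : A →+* B) : Module Aᵐᵒᵖ (Along f) := Module.compHom B f.op

theorem Along.smul_def (f : A →+* B) (a : A) (b : Along f) :
    a • b = (show Along f from f a) * b := rfl

theorem Along.op_smul_def (f : A →+* B) (a : A) (b : Along f) :
    op a • b = b * (show Along f from f a) := rfl

instance (f : A →+* B) : SMulCommClass A Aᵐᵒᵖ (Along f) where
  smul_comm a b x := (mul_assoc (f a) (show B from x) (f b.unop)).symm

/-- `f : A → B` is a Frobenius extension (of the first kind): `B` is a finitely generated
projective right `A`-module, and `B ≅ Hom_A(B, A)` (right `A`-linear maps) as `(A, B)`-bimodules,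
where `(a h b)(x) = a h(b x)`. -/
def IsFrobeniusExtension (f : A →+* B) : Prop :=
  Module.Finite Aᵐᵒᵖ (Along f) ∧ Module.Projective Aᵐᵒᵖ (Along f) ∧
    ∃ φ : Along f ≃+ (Along f →ₗ[Aᵐᵒᵖ] A),
      ∀ (a : A) (b b' x : Along f), φ (a • b * b') x = a * φ b (b' * x)

end Extension

/-- A unital ring structure on a given abelian group. -/
structure RingOn (M : Type u) [AddCommGroup M] where
  mul : M → M → M
  one : M
  mul_assoc : ∀ x y z, mul (mul x y) z = mul x (mul y z)
  one_mul : ∀ x, mul one x = x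
  mul_one : ∀ x, mul x one = x
  left_distrib : ∀ x y z, mul x (y + z) = mul x y + mul x z
  right_distrib : ∀ x y z, mul (x + y) z = mul x z + mul y z

/-- The abelian group `M` as a ring with the multiplication `R`. -/
def RingOn.Carrier {M : Type u} [AddCommGroup M] (_ : RingOn M) : Type u := M

instance {M : Type u} [AddCommGroup M] (R : RingOn M) : AddCommGroup R.Carrier :=
  inferInstanceAs (AddCommGroup M)

instance {M : Type u} [AddCommGroup M] (R : RingOn M) : Ring R.Carrier where
  __ := (inferInstance : AddCommGroup R.Carrier)
  mul := R.mul
  one := R.one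
  mul_assoc := R.mul_assoc
  one_mul := R.one_mul
  mul_one := R.mul_one
  left_distrib := R.left_distrib
  right_distrib := R.right_distrib
  zero_mul x := by
    have h := R.right_distrib 0 0 x
    rw [add_zero] at h
    exact left_eq_add.mp h
  mul_zero x := by
    have h := R.left_distrib x 0 0
    rw [add_zero] at h
    exact left_eq_add.mp h

/-! ## Tensor powers and the maps of the tower -/

/-- Bundled `(A, A)`-bimodules. -/
structure Bimodule (A : Type u) [Ring A] where
  carrier : Type u
  [addCommGroup : AddCommGroup carrier]
  [left : Module A carrier]
  [right : Module Aᵐᵒᵖ carrier]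
  [comm : SMulCommClass A Aᵐᵒᵖ carrier]

attribute [instance] Bimodule.addCommGroup Bimodule.left Bimodule.right Bimodule.comm

section Power

variable (A C : Type u) [Ring A] [AddCommGroup C] [Module A C] [Module Aᵐᵒᵖ C]
  [SMulCommClass A Aᵐᵒᵖ C]

/-- The tensor powers over `A`: `C⁰ = A`, `C¹ = C`, `C² = C ⊗ C`, and beyond that
`Cᵏ⁺² = C ⊗ (Cᵏ ⊗ C)`; so a `k`-fold tensor product is bracketed symmetrically. -/
def tpow : ℕ → Bimodule A
  | 0 => ⟨A⟩
  | 1 => ⟨C⟩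
  | 2 => ⟨Tensor A C C⟩
  | k + 3 => ⟨Tensor A C (Tensor A (tpow (k + 1)).carrier C)⟩

/-- The underlying type of `Cᵏ`. -/
abbrev TPow (k : ℕ) : Type u := (tpow A C k).carrier

end Power

namespace Coring.FrobeniusSystem

variable {A C : Type u} [Ring A] [AddCommGroup C] [Module A C] [Module Aᵐᵒᵖ C]
  [SMulCommClass A Aᵐᵒᵖ C] {𝒞 : Coring A C} (S : 𝒞.FrobeniusSystem)

/-- The map `γ = ε ∘ π : C ⊗ C → A`. -/
def γ : BimodHom A (Tensor A C C) A := 𝒞.counit.comp S.π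

/-- The map `Θ : A → C`, `a ↦ a e = e a`. -/
def Θ : BimodHom A A C where
  toFun a := a • S.e
  map_zero' := zero_smul A S.e
  map_add' a b := add_smul a b S.e
  map_smul' a b := mul_smul a b S.e
  map_op_smul' a b := by
    change (b * a) • S.e = op a • b • S.e
    rw [mul_smul, S.invariant, smul_comm]

/-- The maps `Cᵏ → Cᵏ⁺¹` of the tower: `Θ`, `Δ`, `I ⊗ Θ ⊗ I` (with `C ⊗ C = C ⊗ (A ⊗ C)`),
`I ⊗ Δ ⊗ I`, `I ⊗ I ⊗ Θ ⊗ I ⊗ I`, and so on. -/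
def up : ∀ k : ℕ, BimodHom A (TPow A C k) (TPow A C (k + 1))
  | 0 => S.Θ
  | 1 => 𝒞.comul
  | 2 => BimodHom.tensor (BimodHom.id A C)
      ((BimodHom.tensor S.Θ (BimodHom.id A C)).comp (BimodHom.lidInv A C))
  | k + 3 => BimodHom.tensor (BimodHom.id A C)
      (BimodHom.tensor (up (k + 1)) (BimodHom.id A C))

/-- The maps `Cᵏ⁺¹ → Cᵏ` in the opposite direction: `ε`, `π`, `I ⊗ ε ⊗ I`, `I ⊗ π ⊗ I`,
`I ⊗ I ⊗ ε ⊗ I ⊗ I`, and so on. -/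
def down : ∀ k : ℕ, BimodHom A (TPow A C (k + 1)) (TPow A C k)
  | 0 => 𝒞.counit
  | 1 => S.π
  | 2 => BimodHom.tensor (BimodHom.id A C)
      ((BimodHom.lid A C).comp (BimodHom.tensor 𝒞.counit (BimodHom.id A C)))
  | k + 3 => BimodHom.tensor (BimodHom.id A C)
      (BimodHom.tensor (down (k + 1)) (BimodHom.id A C))

/-- The multiplications on the tensor powers: that of `A` on `C⁰`, `c d = π (c ⊗ d)` on `C¹`,
`(c ⊗ c') (d ⊗ d') = c ⊗ γ(c' ⊗ d) d'` on `C²`, and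
`(c ⊗ x ⊗ c') (d ⊗ y ⊗ d') = c ⊗ x (γ(c' ⊗ d) y) ⊗ d'` on `Cᵏ⁺²`, for `x` and `y` in `Cᵏ`. -/
structure IsTowerMul (R : ∀ k, RingOn (TPow A C k)) : Prop where
  mul_zero : ∀ a b : A, (R 0).mul a b = a * b
  one_zero : (R 0).one = (1 : A)
  mul_one : ∀ c d : C, (R 1).mul c d = S.π (tmul A c d)
  mul_two : ∀ c c' d d' : C,
    (R 2).mul (tmul A c c') (tmul A d d') = tmul A c (S.γ (tmul A c' d) • d')
  mul_add_three : ∀ (k : ℕ) (c c' d d' : C) (x y : TPow A C (k + 1)),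
    (R (k + 3)).mul (tmul A c (tmul A x c')) (tmul A d (tmul A y d')) =
      tmul A c (tmul A ((R (k + 1)).mul x (S.γ (tmul A c' d) • y)) d')

end Coring.FrobeniusSystem

end CoringTower

open CoringTower

/-! The forgetful functor always has the right adjoint `- ⊗ C`. If some functor is both a left and a
right adjoint of it, uniqueness of right adjoints makes `- ⊗ C` a left adjoint too. The value of the
unit of that adjunction at `1 ∈ A` is `e`, and its counit at the regular comodule is `π`; naturality
and the triangle identities are the axioms of a Frobenius system (`systemOfAdj`). Conversely, `π`
and `e` define such an adjunction (`cofreeAdjForget`), which shows every coring of the tower to be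
Frobenius.

Given `(π, e)`, colinearity and the counit axioms give `π(c ⊗ d) = c₁ γ(c₂ ⊗ d) = γ(c ⊗ d₁) d₂`
(`π_eq_rid`, `π_eq_lid`). Hence `π` is associative with unit `e`, and if `Δ(e) = ∑ x_j ⊗ z_j`, then
`∑ x_j γ(z_j ⊗ c) = c = ∑ γ(c ⊗ x_j) z_j`: the legs of `Δ(e)` are dual bases for `γ`.

Everything required at one level `f : X → Y` follows from a single datum: an `X`-bimodule map `E : Y
→ X` with dual bases `u_i, v_i`, that is, `∑ u_i f(E(v_i b)) = b = ∑ f(E(b u_i)) v_i`. It makes `f`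
a Frobenius extension, and it makes `Y` an `X`-coring with coproduct `b ↦ ∑ b u_i ⊗ v_i` and counit
`E`, for which multiplication and unit form a Frobenius system (section `IsDualBasis`).

Such data are built along the tower by an induction in steps of two. The levels `A → C` and `C → C ⊗
C` are done by hand. The passage from `X → Y` to `C ⊗ X ⊗ C → C ⊗ Y ⊗ C` is
`IsTriple.isFrobeniusPair`, stated for any ring that behaves like `C ⊗ X ⊗ C`, so that `C ⊗ C` is
covered as `C ⊗ A ⊗ C`. -/

namespace CoringTower

/-! ### Finite sums in tensor products over a noncommutative ring. -/

namespace Tensor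

variable {A : Type u} [Ring A] {M N P M' N' : Type u}
  [AddCommGroup M] [Module Aᵐᵒᵖ M] [AddCommGroup N] [Module A N]
  [AddCommGroup M'] [Module Aᵐᵒᵖ M'] [AddCommGroup N'] [Module A N']

theorem zero_tmul (n : N) : tmul A (0 : M) n = 0 :=
  map_zero (AddMonoidHom.flip (mk A (M := M)) n)

theorem tmul_sum {ι : Type*} (s : Finset ι) (m : M) (f : ι → N) :
    tmul A m (∑ i ∈ s, f i) = ∑ i ∈ s, tmul A m (f i) := map_sum (mk A m) f s

theorem sum_tmul {ι : Type*} (s : Finset ι) (f : ι → M) (n : N) :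
    tmul A (∑ i ∈ s, f i) n = ∑ i ∈ s, tmul A (f i) n :=
  map_sum (AddMonoidHom.flip (mk A (M := M)) n) f s

/-- Every tensor is a finite sum of pure tensors. -/
theorem exists_eq_sum (t : Tensor A M N) :
    ∃ (ι : Type) (_ : Fintype ι) (x : ι → M) (y : ι → N), t = ∑ i, tmul A (x i) (y i) := by
  induction t using induction_on with
  | h m n => exact ⟨Unit, inferInstance, fun _ => m, fun _ => n, by simp⟩
  | hadd s t hs ht =>
    obtain ⟨ι, _, x, y, rfl⟩ := hs
    obtain ⟨κ, _, z, w, rfl⟩ := ht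
    exact ⟨ι ⊕ κ, inferInstance, Sum.elim x z, Sum.elim y w, by simp⟩

/-- The map `f ⊗ N` is right linear. -/
def mapRight [Module Aᵐᵒᵖ N] [SMulCommClass A Aᵐᵒᵖ N] [Module Aᵐᵒᵖ N'] [SMulCommClass A Aᵐᵒᵖ N']
    (f : M →ₗ[Aᵐᵒᵖ] M') (g : N →ₗ[A] N') (hg : ∀ (a : Aᵐᵒᵖ) n, g (a • n) = a • g n) :
    Tensor A M N →ₗ[Aᵐᵒᵖ] Tensor A M' N' where
  toFun := map f g
  map_add' := map_add _
  map_smul' a t := by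
    induction t using induction_on with
    | h m n => simp [hg]
    | hadd x y hx hy => simp only [smul_add, map_add, hx, hy]

end Tensor

open Tensor

/-! ### Cofree comodules, and the adjunction of the forgetful functor with `- ⊗ C`. -/

namespace Coring

variable {A C : Type u} [Ring A] [AddCommGroup C] [Module A C] [Module Aᵐᵒᵖ C]
  [SMulCommClass A Aᵐᵒᵖ C] (𝒞 : Coring A C)

/-- The coaction `n ⊗ c ↦ n ⊗ Δ c` of the cofree comodule. -/
def cofreeCoact (N : Type u) [AddCommGroup N] [Module Aᵐᵒᵖ N] :
    Tensor A N C →ₗ[Aᵐᵒᵖ] Tensor A (Tensor A N C) C where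
  toFun t := (assoc N C).symm (map LinearMap.id 𝒞.comul.left t)
  map_add' x y := by simp
  map_smul' a t := by
    have key : ∀ (n : N) (s : Tensor A C C), (assoc N C).symm (tmul A n (a • s)) =
        a • (assoc N C).symm (tmul A n s) := by
      intro n s
      induction s using Tensor.induction_on with
      | h p q => simp
      | hadd x y hx hy => simp only [smul_add, tmul_add, map_add, hx, hy]
    induction t using Tensor.induction_on with
    | h m n =>
      have h : 𝒞.comul (a • n) = a • 𝒞.comul n := 𝒞.comul.map_op_smul' a.unop n
      simp [h, key]
    | hadd x y hx hy =>
      simp only [smul_add, map_add, hx, hy]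

theorem cofreeCoact_tmul (N : Type u) [AddCommGroup N] [Module Aᵐᵒᵖ N] (n : N) (c : C) :
    𝒞.cofreeCoact N (tmul A n c) = (assoc N C).symm (tmul A n (𝒞.comul c)) := rfl

/-- The cofree right comodule `N ⊗_A C`. -/
def cofreeObj (N : Type u) [AddCommGroup N] [Module Aᵐᵒᵖ N] : 𝒞.RightComodule where
  carrier := Tensor A N C
  coact := 𝒞.cofreeCoact N
  coassoc t := by
    -- `h1` and `h2` write the two sides as images of `n ⊗ (I ⊗ Δ)Δ(c)` and `n ⊗ (Δ ⊗ I)Δ(c)` under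
    -- the same reassociation, so coassociativity of `C` suffices.
    have h1 : ∀ (n : N) (s : Tensor A C C),
        map LinearMap.id 𝒞.comul.left ((assoc N C).symm (tmul A n s)) =
        (assoc N (Tensor A C C)).symm (tmul A n (map LinearMap.id 𝒞.comul.left s)) := by
      intro n s
      induction s using Tensor.induction_on with
      | h p q => simp
      | hadd x y hx hy => simp only [tmul_add, map_add, hx, hy]
    have h2 : ∀ (n : N) (s : Tensor A C C),
        assoc (Tensor A N C) C (map (𝒞.cofreeCoact N) LinearMap.id
          ((assoc N C).symm (tmul A n s))) =
        (assoc N (Tensor A C C)).symm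
          (tmul A n (assoc C C (map 𝒞.comul.right LinearMap.id s))) := by
      intro n s
      induction s using Tensor.induction_on with
      | h p q =>
        simp only [assoc_symm_tmul, map_tmul, cofreeCoact_tmul, LinearMap.id_apply,
          BimodHom.right_apply]
        induction 𝒞.comul p using Tensor.induction_on with
        | h p q => simp
        | hadd x y hx hy => simp only [tmul_add, add_tmul, map_add, hx, hy]
      | hadd x y hx hy => simp only [tmul_add, map_add, hx, hy]
    induction t using Tensor.induction_on with
    | h n c => rw [cofreeCoact_tmul, h1, h2, 𝒞.coassoc]
    | hadd x y hx hy => simp only [map_add, hx, hy]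
  counit t := by
    have h1 : ∀ (n : N) (s : Tensor A C C),
        rid A (Tensor A N C) (map LinearMap.id 𝒞.counit.left ((assoc N C).symm (tmul A n s))) =
        tmul A n (rid A C (map LinearMap.id 𝒞.counit.left s)) := by
      intro n s
      induction s using Tensor.induction_on with
      | h p q => simp
      | hadd x y hx hy => simp only [tmul_add, map_add, hx, hy]
    induction t using Tensor.induction_on with
    | h n c => rw [cofreeCoact_tmul, h1, 𝒞.rid_counit]
    | hadd x y hx hy => simp only [map_add, hx, hy]

/-- The cofree comodule functor `- ⊗_A C`. -/
def cofree : ModuleCat.{u} Aᵐᵒᵖ ⥤ 𝒞.RightComodule where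
  obj N := 𝒞.cofreeObj N
  map {N N'} f :=
    { toLin := mapRight f.hom LinearMap.id (fun _ _ => rfl)
      comm := fun t => by
        change 𝒞.cofreeCoact N' (map f.hom LinearMap.id t) =
          map (mapRight f.hom LinearMap.id (fun _ _ => rfl)) LinearMap.id (𝒞.cofreeCoact N t)
        induction t using Tensor.induction_on with
        | h n c =>
          rw [map_tmul, cofreeCoact_tmul, cofreeCoact_tmul, LinearMap.id_apply]
          induction 𝒞.comul c using Tensor.induction_on with
          | h p q => rfl
          | hadd x y hx hy => simp only [tmul_add, map_add, hx, hy]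
        | hadd x y hx hy => simp only [map_add, hx, hy] }
  map_id N := RightComodule.Hom.ext (LinearMap.ext fun t =>
    DFunLike.congr_fun (addHom_ext (f := map LinearMap.id LinearMap.id)
      (g := AddMonoidHom.id _) fun _ _ => rfl) t)
  map_comp {N N' N''} f g := RightComodule.Hom.ext (LinearMap.ext fun t =>
    DFunLike.congr_fun (addHom_ext (f := map (g.hom.comp f.hom) (LinearMap.id : C →ₗ[A] C))
      (g := (map g.hom LinearMap.id).comp (map f.hom LinearMap.id)) fun _ _ => rfl) t)

/-- The map `n ⊗ c ↦ n ε(c)`. -/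
def cofreeCounit (N : Type u) [AddCommGroup N] [Module Aᵐᵒᵖ N] : Tensor A N C →ₗ[Aᵐᵒᵖ] N where
  toFun t := rid A N (map LinearMap.id 𝒞.counit.left t)
  map_add' x y := by simp
  map_smul' a t := by
    induction t using Tensor.induction_on with
    | h n c =>
      have h : 𝒞.counit (a • c) = a • 𝒞.counit c := 𝒞.counit.map_op_smul' a.unop c
      simp [h, mul_smul]
    | hadd x y hx hy => simp only [smul_add, map_add, hx, hy]

/-- The cofree comodule functor is right adjoint to the forgetful functor. -/
def forgetAdjCofree : 𝒞.forget ⊣ 𝒞.cofree where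
  unit :=
    -- The unit at `M` is its own coaction, which is colinear by coassociativity; the first triangle
    -- identity is then the counit axiom of `M`.
    { app := fun M => RightComodule.Hom.mk (N := 𝒞.cofreeObj M.carrier) M.coact fun m => by
        change (assoc M.carrier C).symm (map LinearMap.id 𝒞.comul.left (M.coact m)) = _
        rw [M.coassoc, AddEquiv.symm_apply_apply]
        rfl
      naturality := fun M M' f => RightComodule.Hom.ext (LinearMap.ext f.comm) }
  counit :=
    { app := fun N => ModuleCat.ofHom (𝒞.cofreeCounit N)
      naturality := fun N N' f => ModuleCat.hom_ext (LinearMap.ext fun t => by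
        change 𝒞.cofreeCounit N' (map f.hom LinearMap.id t) = f.hom (𝒞.cofreeCounit N t)
        induction t using Tensor.induction_on with
        | h n c => exact (f.hom.map_smul _ _).symm
        | hadd x y hx hy => simp only [map_add, hx, hy]) }
  left_triangle_components M := ModuleCat.hom_ext (LinearMap.ext M.counit)
  right_triangle_components N := RightComodule.Hom.ext (LinearMap.ext fun t => by
    change map (𝒞.cofreeCounit N) LinearMap.id (𝒞.cofreeCoact N t) = t
    have h1 : ∀ (n : N) (s : Tensor A C C),
        map (𝒞.cofreeCounit N) LinearMap.id ((assoc N C).symm (tmul A n s)) =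
        tmul A n (lid A C (map 𝒞.counit.right LinearMap.id s)) := by
      intro n s
      induction s using Tensor.induction_on with
      | h p q => exact smul_tmul A n (𝒞.counit p) q
      | hadd x y hx hy => simp only [tmul_add, map_add, hx, hy]
    induction t using Tensor.induction_on with
    | h n c => rw [cofreeCoact_tmul, h1, 𝒞.lid_counit]
    | hadd x y hx hy => simp only [map_add, hx, hy])

end Coring

/-! ### From a Frobenius system to the adjunction of `- ⊗ C` with the forgetful functor. -/

namespace Coring

variable {A C : Type u} [Ring A] [AddCommGroup C] [Module A C] [Module Aᵐᵒᵖ C]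
  [SMulCommClass A Aᵐᵒᵖ C]

namespace FrobeniusSystem

variable {𝒞 : Coring A C} (S : 𝒞.FrobeniusSystem)

theorem γ_apply (t : Tensor A C C) : S.γ t = 𝒞.counit (S.π t) := rfl

/-- Apply `I ⊗ ε` to left colinearity `Δ(π(c ⊗ d)) = c₁ ⊗ π(c₂ ⊗ d)`. With its mirror image
`π_eq_lid` this reduces computations with `π` to computations with the `A`-valued map `γ`. -/
theorem π_eq_rid (c d : C) :
    S.π (tmul A c d) =
      rid A C (map LinearMap.id S.γ.left (assoc C C (tmul A (𝒞.comul c) d))) := by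
  have h := 𝒞.rid_counit (S.π (tmul A c d))
  rw [S.left_colinear, map_tmul] at h
  rw [← h]
  simp only [LinearMap.id_apply, BimodHom.right_apply]
  induction assoc C C (tmul A (𝒞.comul c) d) using Tensor.induction_on with
  | h p q => rfl
  | hadd x y hx hy => simp only [map_add, hx, hy]

theorem π_eq_lid (c d : C) :
    S.π (tmul A c d) =
      lid A C (map S.γ.right LinearMap.id ((assoc C C).symm (tmul A c (𝒞.comul d)))) := by
  have h := 𝒞.lid_counit (S.π (tmul A c d))
  rw [S.right_colinear, map_tmul] at h
  rw [← h]
  simp only [LinearMap.id_apply, BimodHom.left_apply]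
  induction (assoc C C).symm (tmul A c (𝒞.comul d)) using Tensor.induction_on with
  | h p q => rfl
  | hadd x y hx hy => simp only [map_add, hx, hy]

/-- The map `m ⊗ c ↦ m₀ γ(m₁ ⊗ c)` for a right comodule `M`. -/
def act (M : 𝒞.RightComodule) : Tensor A M.carrier C →ₗ[Aᵐᵒᵖ] M.carrier where
  toFun t := rid A M.carrier (map LinearMap.id S.γ.left
    (assoc M.carrier C (map M.coact LinearMap.id t)))
  map_add' x y := by simp
  map_smul' a t := by
    induction t using Tensor.induction_on with
    | h m c =>
      simp only [op_smul_tmul, map_tmul, LinearMap.id_apply, RingHom.id_apply]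
      induction M.coact m using Tensor.induction_on with
      | h p q =>
        have h : S.γ (tmul A q (a • c)) = a • S.γ (tmul A q c) :=
          S.γ.map_op_smul' a.unop (tmul A q c)
        simp [h, mul_smul]
      | hadd x y hx hy => simp only [add_tmul, smul_add, map_add, hx, hy]
    | hadd x y hx hy => simp only [smul_add, map_add, hx, hy]

theorem act_tmul (M : 𝒞.RightComodule) (m : M.carrier) (c : C) :
    S.act M (tmul A m c) = rid A M.carrier (map LinearMap.id S.γ.left
      (assoc M.carrier C (tmul A (M.coact m) c))) := rfl

theorem coact_act (M : 𝒞.RightComodule) (t : Tensor A M.carrier C) :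
    M.coact (S.act M t) = map (S.act M) LinearMap.id (𝒞.cofreeCoact M.carrier t) := by
  induction t using Tensor.induction_on with
  | hadd x y hx hy => simp only [map_add, hx, hy]
  | h m c =>
    obtain ⟨ι, _, u, v, huv⟩ := exists_eq_sum (M.coact m)
    -- Both sides equal `m₀ ⊗ π(m₁ ⊗ c)`: one by coassociativity of `M` and `π_eq_rid`, the other by
    -- `π_eq_lid`.
    trans ∑ i, tmul A (u i) (S.π (tmul A (v i) c))
    · have h1 : ∀ s : Tensor A M.carrier C,
          M.coact (rid A M.carrier (map LinearMap.id S.γ.left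
            (assoc M.carrier C (tmul A s c)))) =
          rid A (Tensor A M.carrier C) (map LinearMap.id S.γ.left
            (assoc (Tensor A M.carrier C) C (tmul A (map M.coact LinearMap.id s) c))) := by
        intro s
        induction s using Tensor.induction_on with
        | h p q => simp
        | hadd x y hx hy => simp only [add_tmul, map_add, hx, hy]
      have h2 : ∀ (p : M.carrier) (s : Tensor A C C),
          rid A (Tensor A M.carrier C) (map LinearMap.id S.γ.left
            (assoc (Tensor A M.carrier C) C (tmul A ((assoc M.carrier C).symm (tmul A p s)) c))) =
          tmul A p (rid A C (map LinearMap.id S.γ.left (assoc C C (tmul A s c)))) := by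
        intro p s
        induction s using Tensor.induction_on with
        | h p q => simp
        | hadd x y hx hy => simp only [add_tmul, tmul_add, map_add, hx, hy]
      have h3 : map M.coact LinearMap.id (M.coact m) =
          (assoc M.carrier C).symm (map LinearMap.id 𝒞.comul.left (M.coact m)) := by
        rw [M.coassoc, AddEquiv.symm_apply_apply]
      rw [act_tmul, h1, h3, huv]
      simp only [map_sum, sum_tmul, map_tmul, LinearMap.id_apply, BimodHom.left_apply, h2,
        π_eq_rid]
    · have h1 : ∀ t : Tensor A C C,
          map (S.act M) LinearMap.id ((assoc M.carrier C).symm (tmul A m t)) =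
          ∑ i, tmul A (u i) (lid A C (map S.γ.right LinearMap.id
            ((assoc C C).symm (tmul A (v i) t)))) := by
        intro t
        induction t using Tensor.induction_on with
        | h p q =>
          simp only [assoc_symm_tmul, map_tmul, act_tmul, huv, map_sum, sum_tmul, assoc_tmul,
            LinearMap.id_apply, rid_tmul, lid_tmul, BimodHom.left_apply, BimodHom.right_apply,
            smul_tmul]
        | hadd x y hx hy => simp only [tmul_add, map_add, hx, hy, Finset.sum_add_distrib]
      rw [cofreeCoact_tmul, h1]
      simp only [π_eq_lid]

/-- The map `n ↦ n ⊗ e`. -/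
def tmulE (N : Type u) [AddCommGroup N] [Module Aᵐᵒᵖ N] : N →ₗ[Aᵐᵒᵖ] Tensor A N C where
  toFun n := tmul A n S.e
  map_add' x y := add_tmul A x y S.e
  map_smul' a n := by
    have h := S.invariant a.unop
    rw [op_unop] at h
    change tmul A (op a.unop • n) S.e = _
    rw [smul_tmul, h]
    rfl

theorem act_naturality {M M' : 𝒞.RightComodule} (f : RightComodule.Hom M M')
    (t : Tensor A M.carrier C) :
    S.act M' (map f.toLin LinearMap.id t) = f.toLin (S.act M t) := by
  induction t using Tensor.induction_on with
  | h m c =>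
    rw [map_tmul, act_tmul, act_tmul, f.comm]
    induction M.coact m using Tensor.induction_on with
    | h p q => simp
    | hadd x y hx hy => simp only [add_tmul, map_add, hx, hy]
  | hadd x y hx hy => simp only [map_add, hx, hy]

/-- Since `γ(m₁ ⊗ e) = ε(m₁)`, this is the counit axiom of `M`. It is one of the two triangle
identities; `cofreeAct_map_tmulE` is the other. -/
theorem act_tmul_e (M : 𝒞.RightComodule) (m : M.carrier) : S.act M (tmul A m S.e) = m := by
  conv_rhs => rw [← M.counit m]
  rw [act_tmul]
  induction M.coact m using Tensor.induction_on with
  | h p q => simp [γ_apply, S.π_tmul_e]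
  | hadd x y hx hy => simp only [add_tmul, map_add, hx, hy]

/-- The map `(n ⊗ c) ⊗ d ↦ n ⊗ π(c ⊗ d)`. -/
def cofreeAct (N : Type u) [AddCommGroup N] [Module Aᵐᵒᵖ N] :
    Tensor A (Tensor A N C) C →ₗ[Aᵐᵒᵖ] Tensor A N C := S.act (𝒞.cofreeObj N)

theorem cofreeAct_tmul (N : Type u) [AddCommGroup N] [Module Aᵐᵒᵖ N] (n : N) (c d : C) :
    S.cofreeAct N (tmul A (tmul A n c) d) = tmul A n (S.π (tmul A c d)) := by
  change rid A _ (map LinearMap.id S.γ.left (assoc (Tensor A N C) C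
    (tmul A ((assoc N C).symm (tmul A n (𝒞.comul c))) d))) = _
  rw [π_eq_rid]
  induction 𝒞.comul c using Tensor.induction_on with
  | h p q => simp
  | hadd x y hx hy => simp only [add_tmul, tmul_add, map_add, hx, hy]

theorem cofreeAct_map_tmulE (N : Type u) [AddCommGroup N] [Module Aᵐᵒᵖ N] (t : Tensor A N C) :
    S.cofreeAct N (map (S.tmulE N) LinearMap.id t) = t := by
  induction t using Tensor.induction_on with
  | h n c =>
    change S.cofreeAct N (tmul A (tmul A n S.e) c) = _
    rw [cofreeAct_tmul, S.π_e_tmul]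
  | hadd x y hx hy => simp only [map_add, hx, hy]

/-- For a coring with a Frobenius system, the cofree comodule functor is also left adjoint to the
forgetful functor. -/
def cofreeAdjForget : 𝒞.cofree ⊣ 𝒞.forget where
  unit :=
    { app := fun N => ModuleCat.ofHom (S.tmulE N)
      naturality := fun _ _ _ => rfl }
  counit :=
    { app := fun M => RightComodule.Hom.mk (M := 𝒞.cofreeObj M.carrier) (S.act M) (S.coact_act M)
      naturality := fun _ _ f => RightComodule.Hom.ext (LinearMap.ext (S.act_naturality f)) }
  left_triangle_components N := RightComodule.Hom.ext (LinearMap.ext (S.cofreeAct_map_tmulE N))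
  right_triangle_components M := ModuleCat.hom_ext (LinearMap.ext (S.act_tmul_e M))

theorem isFrobenius (S : 𝒞.FrobeniusSystem) : 𝒞.IsFrobenius := ⟨𝒞.cofree, ⟨S.cofreeAdjForget⟩, ⟨𝒞.forgetAdjCofree⟩⟩

end FrobeniusSystem

/-! ### From an adjunction to a Frobenius system. -/

variable (𝒞 : Coring A C)

/-- The coring as a right comodule over itself. -/
def regular : 𝒞.RightComodule where
  carrier := C
  coact := 𝒞.comul.right
  coassoc := 𝒞.coassoc
  counit := 𝒞.rid_counit

section Adjunction

variable (adj : 𝒞.cofree ⊣ 𝒞.forget)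

/-- The unit of an adjunction between the cofree comodule functor and the forgetful functor. -/
def adjUnit (N : Type u) [AddCommGroup N] [Module Aᵐᵒᵖ N] : N →ₗ[Aᵐᵒᵖ] Tensor A N C :=
  (adj.unit.app (ModuleCat.of Aᵐᵒᵖ N)).hom

/-- The counit of an adjunction between the cofree comodule functor and the forgetful functor. -/
def adjCounit (M : 𝒞.RightComodule) : Tensor A M.carrier C →ₗ[Aᵐᵒᵖ] M.carrier :=
  (adj.counit.app M).toLin

variable {𝒞}

theorem adjUnit_naturality {N N' : Type u} [AddCommGroup N] [Module Aᵐᵒᵖ N] [AddCommGroup N']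
    [Module Aᵐᵒᵖ N'] (f : N →ₗ[Aᵐᵒᵖ] N') (n : N) :
    𝒞.adjUnit adj N' (f n) = map f LinearMap.id (𝒞.adjUnit adj N n) :=
  LinearMap.congr_fun (congrArg ModuleCat.Hom.hom (adj.unit.naturality (ModuleCat.ofHom f))) n

theorem adjCounit_naturality {M M' : 𝒞.RightComodule} (f : M ⟶ M') (t : Tensor A M.carrier C) :
    𝒞.adjCounit adj M' (map f.toLin LinearMap.id t) = f.toLin (𝒞.adjCounit adj M t) :=
  LinearMap.congr_fun (congrArg RightComodule.Hom.toLin (adj.counit.naturality f)) t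

theorem adjCounit_map_adjUnit {N : Type u} [AddCommGroup N] [Module Aᵐᵒᵖ N] (t : Tensor A N C) :
    𝒞.adjCounit adj (𝒞.cofreeObj N) (map (𝒞.adjUnit adj N) LinearMap.id t) = t :=
  LinearMap.congr_fun (congrArg RightComodule.Hom.toLin
    (adj.left_triangle_components (ModuleCat.of Aᵐᵒᵖ N))) t

theorem adjCounit_adjUnit (M : 𝒞.RightComodule) (m : M.carrier) :
    𝒞.adjCounit adj M (𝒞.adjUnit adj M.carrier m) = m :=
  LinearMap.congr_fun (congrArg ModuleCat.Hom.hom (adj.right_triangle_components M)) m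

/-- The image of `1` under the unit of the adjunction. -/
def adjE : C := lid A C (𝒞.adjUnit adj A (1 : A))

/-- Naturality along `A → N`, `a ↦ n a`, shows that the whole unit is determined by its value at `1
∈ A`. -/
theorem adjUnit_eq (N : Type u) [AddCommGroup N] [Module Aᵐᵒᵖ N] (n : N) :
    𝒞.adjUnit adj N n = tmul A n (adjE adj) := by
  let f : A →ₗ[Aᵐᵒᵖ] N :=
    { toFun := fun a => op a • n
      map_add' := fun a b => add_smul (op a) (op b) n
      map_smul' := fun a b => mul_smul a (op b) n }
  have h1 : f 1 = n := one_smul _ n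
  have h2 : ∀ t : Tensor A A C, map f (LinearMap.id : C →ₗ[A] C) t = tmul A n (lid A C t) := by
    intro t
    induction t using Tensor.induction_on with
    | h a c => exact smul_tmul A n a c
    | hadd x y hx hy => simp only [tmul_add, map_add, hx, hy]
  conv_lhs => rw [← h1]
  rw [adjUnit_naturality, h2]
  rfl

/-- The unit at `A` is right linear, and it sends `a` both to `a ⊗ e` and to `(1 ⊗ e) a`. -/
theorem smul_adjE (a : A) : a • adjE adj = op a • adjE adj := by
  have h1 : a • adjE adj = lid A C (𝒞.adjUnit adj A a) := by rw [adjUnit_eq, lid_tmul]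
  have h2 : 𝒞.adjUnit adj A a = op a • 𝒞.adjUnit adj A (1 : A) := by
    rw [← map_smul]
    congr 1
    exact (one_mul a).symm
  rw [h1, h2, adjUnit_eq, op_smul_tmul, lid_tmul, one_smul]

/-- The counit of the adjunction at the regular comodule. -/
def adjπ : Tensor A C C →ₗ[Aᵐᵒᵖ] C := 𝒞.adjCounit adj 𝒞.regular

/-- The counit of the adjunction at a cofree comodule. -/
def adjCofreeCounit (N : Type u) [AddCommGroup N] [Module Aᵐᵒᵖ N] :
    Tensor A (Tensor A N C) C →ₗ[Aᵐᵒᵖ] Tensor A N C := 𝒞.adjCounit adj (𝒞.cofreeObj N)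

/-- Left multiplication by `a` is an endomorphism of the regular right comodule, so naturality of
the counit gives left linearity. -/
theorem adjπ_smul (a : A) (t : Tensor A C C) : adjπ adj (a • t) = a • adjπ adj t :=
  adjCounit_naturality (M := 𝒞.regular) (M' := 𝒞.regular) adj
    (RightComodule.Hom.mk (M := 𝒞.regular) (N := 𝒞.regular) (Tensor.leftMul (A := A) C a)
      (𝒞.comul.map_smul' a)) t

theorem comul_eq_map (d : C) : 𝒞.cofreeCoact C (𝒞.comul d) =
    map 𝒞.comul.right LinearMap.id (𝒞.comul d) := by
  change (assoc C C).symm (map LinearMap.id 𝒞.comul.left (𝒞.comul d)) = _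
  rw [𝒞.coassoc, AddEquiv.symm_apply_apply]

/-- Naturality of the counit along `Δ`, which by coassociativity is a comodule map from `C` to the
cofree comodule `C ⊗ C`. -/
theorem comul_adjπ (t : Tensor A C C) :
    𝒞.comul (adjπ adj t) = adjCofreeCounit adj C (map 𝒞.comul.right LinearMap.id t) :=
  (adjCounit_naturality (M := 𝒞.regular) (M' := 𝒞.cofreeObj C) adj
    (RightComodule.Hom.mk (M := 𝒞.regular) (N := 𝒞.cofreeObj C) 𝒞.comul.right
      (comul_eq_map (C := C)))
      t).symm

theorem cofreeCoact_tmul_eq_map {N : Type u} [AddCommGroup N] [Module Aᵐᵒᵖ N] (n : N) (d : C)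
    (f : C →ₗ[Aᵐᵒᵖ] Tensor A N C) (hf : ∀ c, f c = tmul A n c) :
    𝒞.cofreeCoact N (f d) = map f LinearMap.id (𝒞.comul d) := by
  rw [hf, cofreeCoact_tmul]
  induction 𝒞.comul d using Tensor.induction_on with
  | h p q => simp [hf]
  | hadd x y hx hy => simp only [tmul_add, map_add, hx, hy]

/-- Naturality along the comodule map `c ↦ n ⊗ c` from `C` to `N ⊗ C`: the counit at a cofree
comodule is `N ⊗ π`. -/
theorem adjCofreeCounit_tmul {N : Type u} [AddCommGroup N] [Module Aᵐᵒᵖ N] (n : N) (c d : C) :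
    adjCofreeCounit adj N (tmul A (tmul A n c) d) = tmul A n (adjπ adj (tmul A c d)) :=
  let f : C →ₗ[Aᵐᵒᵖ] Tensor A N C :=
    { toFun := tmul A n
      map_add' := tmul_add A n
      map_smul' := fun _ _ => rfl }
  adjCounit_naturality (M := 𝒞.regular) (M' := 𝒞.cofreeObj N) adj
    (RightComodule.Hom.mk (M := 𝒞.regular) (N := 𝒞.cofreeObj N) f
      (fun d => cofreeCoact_tmul_eq_map (C := C) n d f (fun _ => rfl))) (tmul A c d : Tensor A C C)

theorem adjπ_adjUnit (c : C) : adjπ adj (𝒞.adjUnit adj C c) = c :=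
  adjCounit_adjUnit adj 𝒞.regular c

theorem adjCofreeCounit_map {N : Type u} [AddCommGroup N] [Module Aᵐᵒᵖ N] (t : Tensor A N C) :
    adjCofreeCounit adj N (map (𝒞.adjUnit adj N) LinearMap.id t) = t :=
  adjCounit_map_adjUnit adj t

/-- The bimodule map given by the counit of the adjunction at the regular comodule. -/
def adjπHom : BimodHom A (Tensor A C C) C where
  toFun := adjπ adj
  map_zero' := map_zero (adjπ adj)
  map_add' := map_add (adjπ adj)
  map_smul' := adjπ_smul adj
  map_op_smul' a t := (adjπ adj).map_smul (op a) t

@[simp] theorem adjπHom_apply (t : Tensor A C C) : adjπHom adj t = adjπ adj t := rfl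

/-- An adjunction between the cofree comodule functor and the forgetful functor gives a Frobenius
system. -/
def systemOfAdj : 𝒞.FrobeniusSystem where
  π := adjπHom adj
  e := adjE adj
  invariant := smul_adjE adj
  left_colinear t := by
    rw [adjπHom_apply, comul_adjπ]
    induction map 𝒞.comul.right (LinearMap.id : C →ₗ[A] C) t using Tensor.induction_on with
    | h s d =>
      induction s using Tensor.induction_on with
      | h p q => simp [adjCofreeCounit_tmul]
      | hadd x y hx hy => simp only [add_tmul, map_add, hx, hy]
    | hadd x y hx hy => simp only [map_add, hx, hy]
  -- The counit is itself a morphism of right comodules, so this side needs no naturality.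
  right_colinear t := (adj.counit.app 𝒞.regular).comm t
  π_tmul_e c := by
    -- The two identities for `e` are the two triangle identities, at the regular comodule and at
    -- the module `A`.
    have h := adjπ_adjUnit adj c
    rwa [adjUnit_eq] at h
  π_e_tmul c := by
    have h := adjCofreeCounit_map adj (tmul A (1 : A) c)
    rw [map_tmul, adjUnit_eq, adjCofreeCounit_tmul] at h
    have h2 := congrArg (lid A C) h
    rwa [lid_tmul, lid_tmul, one_smul, one_smul] at h2

end Adjunction

variable {𝒞}

/-- The given two-sided adjoint `G` and `- ⊗ C` are both right adjoints of the forgetful functor,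
hence isomorphic; so `- ⊗ C` inherits the left adjunction of `G`. -/
theorem IsFrobenius.nonempty_frobeniusSystem (h : 𝒞.IsFrobenius) :
    Nonempty 𝒞.FrobeniusSystem := by
  obtain ⟨G, ⟨adj⟩, ⟨adj'⟩⟩ := h
  exact ⟨systemOfAdj (adj.ofNatIsoLeft (adj'.rightAdjointUniq 𝒞.forgetAdjCofree))⟩

end Coring

/-! ### Dual bases: the coring, its Frobenius system and the Frobenius extension. -/

namespace Along

variable {A B : Type u} [Ring A] [Ring B] {f : A →+* B}

theorem smul_mul (a : A) (b c : Along f) : a • b * c = a • (b * c) := by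
  rw [smul_def, smul_def, mul_assoc]

theorem mul_op_smul (a : A) (b c : Along f) : b * op a • c = op a • (b * c) := by
  rw [op_smul_def, op_smul_def, mul_assoc]

theorem op_smul_mul (a : A) (b c : Along f) : op a • b * c = b * a • c := by
  rw [op_smul_def, smul_def, mul_assoc]

variable (f) in
/-- The multiplication of `B` as a bimodule map `B ⊗_A B → B`. -/
def mulHom : BimodHom A (Tensor A (Along f) (Along f)) (Along f) where
  toAddMonoidHom := lift A AddMonoidHom.mul (fun b a c => op_smul_mul a b c)
  map_smul' a t := by
    change lift A AddMonoidHom.mul _ (a • t) = a • lift A AddMonoidHom.mul _ t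
    induction t using Tensor.induction_on with
    | h b c => exact smul_mul a b c
    | hadd x y hx hy => simp only [smul_add, map_add, hx, hy]
  map_op_smul' a t := by
    change lift A AddMonoidHom.mul _ (op a • t) = op a • lift A AddMonoidHom.mul _ t
    induction t using Tensor.induction_on with
    | h b c => exact mul_op_smul a b c
    | hadd x y hx hy => simp only [smul_add, map_add, hx, hy]

@[simp] theorem mulHom_tmul (b c : Along f) : mulHom f (tmul A b c) = b * c := rfl

end Along

/-- The families `x` and `y` are dual bases for the bimodule map `E : B → A`. -/
structure IsDualBasis {A B : Type u} [Ring A] [Ring B] {f : A →+* B} (E : BimodHom A (Along f) A)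
    {ι : Type} [Fintype ι] (x y : ι → Along f) : Prop where
  sum_op_smul : ∀ b, ∑ i, op (E (y i * b)) • x i = b
  sum_smul : ∀ b, ∑ i, E (b * x i) • y i = b

namespace IsDualBasis

variable {A B : Type u} [Ring A] [Ring B] {f : A →+* B} {E : BimodHom A (Along f) A}
  {ι : Type} [Fintype ι] {x y : ι → Along f}

/-- Two pairs of dual bases for the same map define the same tensor, up to the action of `B`. -/
theorem sum_tmul_eq (h : IsDualBasis E x y) {κ : Type} [Fintype κ] {x' y' : κ → Along f} (h' : IsDualBasis E x' y')
    (b c : Along f) :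
    ∑ i, tmul A (b * c * x i) (y i) = ∑ j, tmul A (b * x' j) (y' j * c) := by
  -- Expand `c x_i` in the `x'_j`, move the coefficients `E(y'_j c x_i) ∈ A` across the tensor sign,
  -- and collapse the sum over `i` by the other dual basis identity.
  calc ∑ i, tmul A (b * c * x i) (y i)
      = ∑ i, ∑ j, tmul A (b * x' j) (E (y' j * c * x i) • y i) := by
        refine Finset.sum_congr rfl fun i _ => ?_
        rw [mul_assoc b c (x i)]
        conv_lhs => rw [← h'.sum_op_smul (c * x i)]
        rw [Finset.mul_sum, sum_tmul]
        refine Finset.sum_congr rfl fun j _ => ?_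
        rw [Along.mul_op_smul, smul_tmul, mul_assoc]
    _ = ∑ j, tmul A (b * x' j) (y' j * c) := by
        rw [Finset.sum_comm]
        refine Finset.sum_congr rfl fun j _ => ?_
        rw [← tmul_sum, h.sum_smul]

variable (h : IsDualBasis E x y)

/-- The coproduct `b ↦ ∑ i, b x i ⊗ y i`. -/
def comul : BimodHom A (Along f) (Tensor A (Along f) (Along f)) where
  toFun b := ∑ i, tmul A (b * x i) (y i)
  map_zero' := by simp [zero_tmul]
  map_add' b c := by simp [add_mul, add_tmul, Finset.sum_add_distrib]
  map_smul' a b := by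
    simp only [Finset.smul_sum, smul_tmul', Along.smul_mul]
  map_op_smul' a b := by
    -- Right linearity holds because `∑ x_i ⊗ y_i` commutes with `B`: the comparison of the dual
    -- bases with themselves.
    have h1 := h.sum_tmul_eq h b (show Along f from f a)
    rw [← Along.op_smul_def] at h1
    rw [h1, Finset.smul_sum]
    rfl

theorem comul_apply (b : Along f) : h.comul b = ∑ i, tmul A (b * x i) (y i) := rfl

/-- The coring structure on `B` defined by dual bases. -/
def coring : Coring A (Along f) where
  comul := h.comul
  counit := E
  coassoc b := by
    simp only [comul_apply, map_sum, map_tmul, LinearMap.id_apply, BimodHom.left_apply,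
      BimodHom.right_apply, tmul_sum, sum_tmul, assoc_tmul]
    rw [Finset.sum_comm]
    refine Finset.sum_congr rfl fun j _ => ?_
    -- For fixed `j`, coassociativity is `∑ b x_j x_i ⊗ y_i = ∑ b x_i ⊗ y_i x_j`, tensored with
    -- `y_j`.
    have h1 := congrArg (fun t => assoc (Along f) (Along f) (tmul A t (y j)))
      (h.sum_tmul_eq h b (x j))
    simp only [sum_tmul, map_sum, assoc_tmul] at h1
    exact h1.symm
  rid_counit b := by
    have h1 := congrArg (b * ·) (h.sum_op_smul 1)
    simp only [mul_one, Finset.mul_sum, Along.mul_op_smul] at h1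
    simpa only [comul_apply, map_sum, map_tmul, LinearMap.id_apply, BimodHom.left_apply,
      rid_tmul] using h1
  lid_counit b := by
    simpa only [comul_apply, map_sum, map_tmul, LinearMap.id_apply, BimodHom.right_apply,
      lid_tmul] using h.sum_smul b

/-- The multiplication and the unit of `B` form a Frobenius system. -/
def frobeniusSystem : h.coring.FrobeniusSystem where
  π := Along.mulHom f
  e := 1
  invariant a := by rw [Along.smul_def, Along.op_smul_def, mul_one, one_mul]
  left_colinear t := by
    induction t using Tensor.induction_on with
    | h b c =>
      change h.comul (b * c) = map LinearMap.id (Along.mulHom f).left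
        (assoc (Along f) (Along f) (tmul A (h.comul b) c))
      simpa only [comul_apply, map_sum, sum_tmul, assoc_tmul, map_tmul, LinearMap.id_apply,
        BimodHom.left_apply, Along.mulHom_tmul] using h.sum_tmul_eq h b c
    | hadd x y hx hy => simp only [map_add, hx, hy]
  right_colinear t := by
    induction t using Tensor.induction_on with
    | h b c =>
      change h.comul (b * c) = map (Along.mulHom f).right LinearMap.id
        ((assoc (Along f) (Along f)).symm (tmul A b (h.comul c)))
      simp only [comul_apply, map_sum, tmul_sum, assoc_symm_tmul, map_tmul, LinearMap.id_apply,
        BimodHom.right_apply, Along.mulHom_tmul, mul_assoc]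
    | hadd x y hx hy => simp only [map_add, hx, hy]
  π_tmul_e := mul_one
  π_e_tmul := one_mul

/-- The right linear map `c ↦ E (b c)`. -/
def coord (b : Along f) (E : BimodHom A (Along f) A) : Along f →ₗ[Aᵐᵒᵖ] A where
  toFun c := E (b * c)
  map_add' c d := by rw [mul_add, map_add]
  map_smul' a c := by
    have h1 : b * a • c = a • (b * c) := Along.mul_op_smul a.unop b c
    rw [h1]
    exact E.map_op_smul' a.unop _

/-- The isomorphism `B ≃ Hom_A(B, A)`, `b ↦ E (b -)`. -/
def homEquiv : Along f ≃+ (Along f →ₗ[Aᵐᵒᵖ] A) where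
  toFun b := coord b E
  invFun g := ∑ i, g (x i) • y i
  left_inv b := h.sum_smul b
  right_inv g := by
    ext b
    change E ((∑ i, g (x i) • y i) * b) = g b
    conv_rhs => rw [← h.sum_op_smul b]
    rw [Finset.sum_mul, map_sum, map_sum]
    refine Finset.sum_congr rfl fun i _ => ?_
    rw [Along.smul_mul, g.map_smul (op (E (y i * b))) (x i)]
    exact E.map_smul' (g (x i)) (y i * b)
  map_add' b c := LinearMap.ext fun d => by
    change E ((b + c) * d) = E (b * d) + E (c * d)
    rw [add_mul, map_add]

/-- The expansion `b = ∑ x_i E(y_i b)` exhibits `B` as a direct summand of the right module `A^ι`,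
and `b ↦ E(b -)` is the required isomorphism. -/
theorem isFrobeniusExtension (h : IsDualBasis E x y) : IsFrobeniusExtension f := by
  let r : (ι → A) →ₗ[Aᵐᵒᵖ] Along f :=
    { toFun := fun c => ∑ i, op (c i) • x i
      map_add' := fun c d => by simp [add_smul, Finset.sum_add_distrib]
      map_smul' := fun a c => by simp [Finset.smul_sum, mul_smul] }
  let s : Along f →ₗ[Aᵐᵒᵖ] (ι → A) := LinearMap.pi fun i => coord (y i) E
  have hrs : r.comp s = LinearMap.id := LinearMap.ext h.sum_op_smul
  -- As a right module over itself, `A` is isomorphic to the regular left module of `Aᵐᵒᵖ`.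
  have hfree : Module.Free Aᵐᵒᵖ A := Module.Free.of_equiv (opLinearEquiv Aᵐᵒᵖ).symm
  have hfin : Module.Finite Aᵐᵒᵖ A := Module.Finite.equiv (opLinearEquiv Aᵐᵒᵖ).symm
  refine ⟨Module.Finite.of_surjective r fun b => ⟨s b, LinearMap.congr_fun hrs b⟩,
    Module.Projective.of_split s r hrs, h.homEquiv, fun a b b' c => ?_⟩
  change E (a • b * b' * c) = a * E (b * (b' * c))
  rw [Along.smul_mul, Along.smul_mul, mul_assoc]
  exact E.map_smul' a _

end IsDualBasis

/-! ### Balanced multiplications, and the ring `C ⊗ X ⊗ C`. -/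

namespace RingOn

variable {M N : Type u} [AddCommGroup M] [AddCommGroup N] (R : RingOn M)

/-- The multiplication as a biadditive map. -/
def mulHom : M →+ M →+ M :=
  AddMonoidHom.mk' (fun x => AddMonoidHom.mk' (R.mul x) (R.left_distrib x))
    (fun x y => AddMonoidHom.ext (R.right_distrib x y))

theorem mul_sum {ι : Type*} (s : Finset ι) (x : M) (f : ι → M) :
    R.mul x (∑ i ∈ s, f i) = ∑ i ∈ s, R.mul x (f i) := map_sum (R.mulHom x) f s

theorem sum_mul {ι : Type*} (s : Finset ι) (f : ι → M) (x : M) :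
    R.mul (∑ i ∈ s, f i) x = ∑ i ∈ s, R.mul (f i) x :=
  map_sum (AddMonoidHom.flip R.mulHom x) f s

/-- A ring structure transported along an isomorphism of abelian groups. -/
def transport (φ : N ≃+ M) : RingOn N where
  mul x y := φ.symm (R.mul (φ x) (φ y))
  one := φ.symm R.one
  mul_assoc x y z := by simp [R.mul_assoc]
  one_mul x := by simp [R.one_mul]
  mul_one x := by simp [R.mul_one]
  left_distrib x y z := by simp [R.left_distrib]
  right_distrib x y z := by simp [R.right_distrib]

variable (A : Type u) [Ring A] [Module A M] [Module Aᵐᵒᵖ M] [Module A N] [Module Aᵐᵒᵖ N]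

/-- The multiplication on the bimodule `M` is `A`-balanced and a bimodule map. -/
structure IsBalanced : Prop where
  smul_mul : ∀ (a : A) (x y : M), R.mul (a • x) y = a • R.mul x y
  mul_op_smul : ∀ (a : A) (x y : M), R.mul x (op a • y) = op a • R.mul x y
  op_smul_mul : ∀ (a : A) (x y : M), R.mul (op a • x) y = R.mul x (a • y)

variable {A R}

theorem IsBalanced.mul_smul_one (hR : R.IsBalanced A) (a : A) (x : M) :
    R.mul x (a • R.one) = op a • x := by
  rw [← hR.op_smul_mul, R.mul_one]

theorem IsBalanced.transport (hR : R.IsBalanced A) (φ : N ≃+ M)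
    (h : ∀ (a : A) x, φ (a • x) = a • φ x) (h' : ∀ (a : A) x, φ (op a • x) = op a • φ x) :
    (R.transport φ).IsBalanced A where
  smul_mul a x y := by
    apply φ.injective
    simp [RingOn.transport, h, hR.smul_mul]
  mul_op_smul a x y := by
    apply φ.injective
    simp [RingOn.transport, h', hR.mul_op_smul]
  op_smul_mul a x y := by
    apply φ.injective
    simp [RingOn.transport, h, h', hR.op_smul_mul]

end RingOn

variable {A C X : Type u} [Ring A] [AddCommGroup C] [Module A C] [Module Aᵐᵒᵖ C]
  [SMulCommClass A Aᵐᵒᵖ C] [AddCommGroup X] [Module A X] [Module Aᵐᵒᵖ X]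
  [SMulCommClass A Aᵐᵒᵖ X]

namespace Tensor

theorem induction_on_triple {p : Tensor A C (Tensor A X C) → Prop} (t : Tensor A C (Tensor A X C))
    (h : ∀ c x c', p (tmul A c (tmul A x c'))) (hadd : ∀ x y, p x → p y → p (x + y)) : p t := by
  induction t using induction_on with
  | h c s =>
    induction s using induction_on with
    | h x c' => exact h c x c'
    | hadd x y hx hy => rw [tmul_add]; exact hadd _ _ hx hy
  | hadd x y hx hy => exact hadd _ _ hx hy

variable (A C X) in
/-- The triadditive map `(c, x, c') ↦ c ⊗ x ⊗ c'`. -/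
def mk₃ : C →+ X →+ C →+ Tensor A C (Tensor A X C) :=
  AddMonoidHom.mk' (fun c => (mk A c).compHom.comp (mk A)) (fun c d => by
    ext x c'
    exact add_tmul A c d (tmul A x c'))

theorem mk₃_apply (c : C) (x : X) (c' : C) : mk₃ A C X c x c' = tmul A c (tmul A x c') := rfl

/-- The homomorphism induced by a balanced triadditive map. -/
def lift₃ {P : Type u} [AddCommGroup P] (g : C →+ X →+ C →+ P)
    (h1 : ∀ c (a : A) x c', g (op a • c) x c' = g c (a • x) c')
    (h2 : ∀ c (a : A) x c', g c (op a • x) c' = g c x (a • c')) :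
    Tensor A C (Tensor A X C) →+ P :=
  lift A (AddMonoidHom.mk' (fun c => lift A (g c) (fun x a c' => h2 c a x c'))
    (fun c d => addHom_ext fun x c' => by simp))
    (fun c a s => by
      induction s using induction_on with
      | h x c' => exact h1 c a x c'
      | hadd x y hx hy => simp only [smul_add, map_add, hx, hy])

end Tensor

namespace Coring.FrobeniusSystem

variable {𝒞 : Coring A C} (S : 𝒞.FrobeniusSystem)

theorem γ_smul (a : A) (c d : C) : S.γ (tmul A (a • c) d) = a * S.γ (tmul A c d) :=
  S.γ.map_smul' a (tmul A c d)

theorem γ_op_smul (a : A) (c d : C) : S.γ (tmul A c (op a • d)) = S.γ (tmul A c d) * a :=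
  S.γ.map_op_smul' a (tmul A c d)

theorem γ_add_left (c c' d : C) :
    S.γ (tmul A (c + c') d) = S.γ (tmul A c d) + S.γ (tmul A c' d) := by
  rw [add_tmul, map_add]

theorem γ_add_right (c d d' : C) :
    S.γ (tmul A c (d + d')) = S.γ (tmul A c d) + S.γ (tmul A c d') := by
  rw [tmul_add, map_add]

/-- `x` and `z` are the two legs of the coproduct of `e`. -/
def IsCasimir {ι : Type} [Fintype ι] (x z : ι → C) : Prop :=
  𝒞.comul S.e = ∑ j, tmul A (x j) (z j)

section Casimir

variable {S} {ι : Type} [Fintype ι] {x z : ι → C}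

/-- Substitute `Δ(e)` into `π_eq_rid` for `π(e ⊗ c) = c`. With `sum_smul`, the legs of `Δ(e)` become
dual bases for `γ`. -/
theorem IsCasimir.sum_op_smul (h : S.IsCasimir x z) (c : C) :
    ∑ j, op (S.γ (tmul A (z j) c)) • x j = c := by
  have h1 := S.π_eq_rid S.e c
  rw [S.π_e_tmul, h] at h1
  simpa only [sum_tmul, map_sum, assoc_tmul, map_tmul, LinearMap.id_apply, BimodHom.left_apply,
    rid_tmul] using h1.symm

theorem IsCasimir.sum_smul (h : S.IsCasimir x z) (c : C) :
    ∑ j, S.γ (tmul A c (x j)) • z j = c := by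
  have h1 := S.π_eq_lid c S.e
  rw [S.π_tmul_e, h] at h1
  simpa only [tmul_sum, map_sum, assoc_symm_tmul, map_tmul, LinearMap.id_apply,
    BimodHom.right_apply, lid_tmul] using h1.symm

end Casimir

/-- Both sides equal `γ(c ⊗ d₁) γ(d₂ ⊗ d')`. -/
theorem γ_π (c d d' : C) :
    S.γ (tmul A (S.π (tmul A c d)) d') = S.γ (tmul A c (S.π (tmul A d d'))) := by
  rw [S.π_eq_lid c d, S.π_eq_rid d d']
  induction 𝒞.comul d using Tensor.induction_on with
  | h p q => simp [γ_smul, γ_op_smul]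
  | hadd x y hx hy => simp only [tmul_add, add_tmul, map_add, hx, hy]

/-- By left colinearity the two sides are `c₁ γ(π(c₂ ⊗ d) ⊗ d')` and `c₁ γ(c₂ ⊗ π(d ⊗ d'))`, so
associativity of `π` reduces to `γ_π`. -/
theorem π_assoc (c d d' : C) :
    S.π (tmul A (S.π (tmul A c d)) d') = S.π (tmul A c (S.π (tmul A d d'))) := by
  rw [S.π_eq_rid (S.π (tmul A c d)) d', S.π_eq_rid c (S.π _), S.left_colinear, map_tmul]
  simp only [LinearMap.id_apply, BimodHom.right_apply]
  induction 𝒞.comul c using Tensor.induction_on with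
  | h p q => simp [γ_π]
  | hadd x y hx hy => simp only [add_tmul, map_add, hx, hy]

/-- The map `(c', d ⊗ w) ↦ γ(c' ⊗ d) w`. -/
def contract (W : Type u) [AddCommGroup W] [Module A W] : C →+ Tensor A C W →+ W :=
  AddMonoidHom.mk' (fun c' => lift A
    (AddMonoidHom.mk' (fun d => smulAddHom A W (S.γ (tmul A c' d))) (fun d d' => by
      rw [γ_add_right, map_add]))
    (fun d a w => by simp [γ_op_smul, mul_smul]))
    (fun c c' => addHom_ext fun d w => by
      simp [γ_add_left])

end Coring.FrobeniusSystem

/-- Left multiplication on the first factor of `X ⊗ C`. -/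
def RingOn.IsBalanced.mulTensor {R : RingOn X} (hR : R.IsBalanced A) :
    X →+ Tensor A X C →+ Tensor A X C :=
  AddMonoidHom.mk' (fun x => map
    { toFun := R.mul x
      map_add' := R.left_distrib x
      map_smul' := fun a y => hR.mul_op_smul a.unop x y } LinearMap.id)
    (fun x y => addHom_ext fun w c =>
      (congrArg (tmul A · c) (R.right_distrib x y w)).trans (add_tmul A _ _ c))

namespace Coring.FrobeniusSystem

variable {𝒞 : Coring A C} (S : 𝒞.FrobeniusSystem) {R : RingOn X} (hR : R.IsBalanced A)

/-- Left multiplication by `c ⊗ x ⊗ c'`. -/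
def tripleMulLeft (c : C) (x : X) (c' : C) :
    Tensor A C (Tensor A X C) →+ Tensor A C (Tensor A X C) :=
  (Tensor.mk A c).comp ((hR.mulTensor x).comp (S.contract _ c'))

theorem tripleMulLeft_apply (c : C) (x : X) (c' : C) (t : Tensor A C (Tensor A X C)) :
    S.tripleMulLeft hR c x c' t = tmul A c (hR.mulTensor x (S.contract _ c' t)) := rfl

theorem tripleMulLeft_tmul (c c' d d' : C) (x y : X) :
    S.tripleMulLeft hR c x c' (tmul A d (tmul A y d')) =
      tmul A c (tmul A (R.mul x (S.γ (tmul A c' d) • y)) d') := rfl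

/-- Left multiplication by `c ⊗ x ⊗ c'`, as a triadditive map. -/
def tripleMulHom : C →+ X →+ C →+ Tensor A C (Tensor A X C) →+ Tensor A C (Tensor A X C) :=
  AddMonoidHom.mk' (fun c => AddMonoidHom.mk' (fun x => AddMonoidHom.mk'
      (fun c' => S.tripleMulLeft hR c x c')
      (fun c' d' => by
        ext t
        rw [AddMonoidHom.add_apply]
        simp only [tripleMulLeft_apply, map_add, AddMonoidHom.add_apply, tmul_add]))
      (fun x y => by
        ext c' t
        simp only [AddMonoidHom.add_apply, AddMonoidHom.mk'_apply]
        simp only [tripleMulLeft_apply, map_add, AddMonoidHom.add_apply, tmul_add]))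
    (fun c d => by
      ext x c' t
      simp only [AddMonoidHom.add_apply, AddMonoidHom.mk'_apply]
      simp only [tripleMulLeft_apply, add_tmul])

theorem tripleMulHom_apply (c : C) (x : X) (c' : C) :
    S.tripleMulHom hR c x c' = S.tripleMulLeft hR c x c' := rfl

/-- The multiplication `(c ⊗ x ⊗ c') (d ⊗ y ⊗ d') = c ⊗ x (γ(c' ⊗ d) y) ⊗ d'`. -/
def tripleMul : Tensor A C (Tensor A X C) →+ Tensor A C (Tensor A X C) →+
    Tensor A C (Tensor A X C) :=
  lift₃ (S.tripleMulHom hR)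
    (fun c a x c' => by
      ext t
      simp only [tripleMulHom_apply]
      induction t using induction_on_triple with
      | h d y d' => simp only [tripleMulLeft_tmul, smul_tmul, hR.smul_mul, smul_tmul']
      | hadd x y hx hy => rw [map_add, map_add, hx, hy])
    (fun c a x c' => by
      ext t
      simp only [tripleMulHom_apply]
      induction t using induction_on_triple with
      | h d y d' => simp only [tripleMulLeft_tmul, γ_smul, mul_smul, hR.op_smul_mul]
      | hadd x y hx hy => rw [map_add, map_add, hx, hy])

theorem tripleMul_tmul (c c' d d' : C) (x y : X) :
    S.tripleMul hR (tmul A c (tmul A x c')) (tmul A d (tmul A y d')) =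
      tmul A c (tmul A (R.mul x (S.γ (tmul A c' d) • y)) d') := rfl

variable {S} {ι : Type} [Fintype ι] {x z : ι → C} (h : S.IsCasimir x z)

/-- The ring structure on `C ⊗ (X ⊗ C)`. -/
def tripleRing (h : S.IsCasimir x z) (hR : R.IsBalanced A) :
    RingOn (Tensor A C (Tensor A X C)) where
  mul s t := S.tripleMul hR s t
  -- This is `Δ(e)` with `1` inserted in the middle; the two unit laws are the two dual basis
  -- identities for `γ`.
  one := ∑ j, tmul A (x j) (tmul A R.one (z j))
  mul_assoc r s t := by
    induction r using induction_on_triple with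
    | hadd x y hx hy => simp only [map_add, AddMonoidHom.add_apply, hx, hy]
    | h c x c' =>
      induction s using induction_on_triple with
      | hadd x y hx hy => simp only [map_add, AddMonoidHom.add_apply, hx, hy]
      | h d y d' =>
        induction t using induction_on_triple with
        | hadd x y hx hy => simp only [map_add, hx, hy]
        | h e w e' => simp only [tripleMul_tmul, R.mul_assoc, hR.smul_mul]
  one_mul t := by
    induction t using induction_on_triple with
    | hadd x y hx hy => simp only [map_add, hx, hy]
    | h d y d' =>
      simp only [map_sum, AddMonoidHom.finsetSum_apply, tripleMul_tmul, R.one_mul]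
      simp only [← smul_tmul', ← smul_tmul, ← sum_tmul, h.sum_op_smul]
  mul_one t := by
    induction t using induction_on_triple with
    | hadd x y hx hy => simp only [map_add, AddMonoidHom.add_apply, hx, hy]
    | h d y d' =>
      simp only [map_sum, tripleMul_tmul, hR.mul_smul_one, smul_tmul, ← tmul_sum, h.sum_smul]
  left_distrib x y z := map_add _ y z
  right_distrib x y z := by rw [map_add, AddMonoidHom.add_apply]

theorem tripleRing_isBalanced : (tripleRing h hR).IsBalanced A where
  smul_mul a s t := by
    change S.tripleMul hR _ _ = a • S.tripleMul hR _ _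
    induction s using induction_on_triple with
    | hadd x y hx hy => simp only [smul_add, map_add, AddMonoidHom.add_apply, hx, hy]
    | h c x c' =>
      induction t using induction_on_triple with
      | hadd x y hx hy => simp only [smul_add, map_add, hx, hy]
      | h d y d' => simp only [smul_tmul', tripleMul_tmul]
  mul_op_smul a s t := by
    change S.tripleMul hR _ _ = op a • S.tripleMul hR _ _
    induction s using induction_on_triple with
    | hadd x y hx hy => simp only [smul_add, map_add, AddMonoidHom.add_apply, hx, hy]
    | h c x c' =>
      induction t using induction_on_triple with
      | hadd x y hx hy => simp only [smul_add, map_add, hx, hy]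
      | h d y d' => simp only [op_smul_tmul, tripleMul_tmul]
  op_smul_mul a s t := by
    change S.tripleMul hR _ _ = S.tripleMul hR _ _
    induction s using induction_on_triple with
    | hadd x y hx hy => simp only [smul_add, map_add, AddMonoidHom.add_apply, hx, hy]
    | h c x c' =>
      induction t using induction_on_triple with
      | hadd x y hx hy => simp only [smul_add, map_add, hx, hy]
      | h d y d' => simp only [op_smul_tmul, smul_tmul', tripleMul_tmul, smul_tmul]

end Coring.FrobeniusSystem

/-! ### Frobenius pairs, and the step from `X → Y` to `C ⊗ X ⊗ C → C ⊗ Y ⊗ C`. -/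

/-- Ring structures on `X` and `Y`, a ring map `f : X → Y` and an `X`-bimodule map `E : Y → X` which
admits dual bases. -/
structure IsFrobeniusPair {A X Y : Type u} [Ring A] [AddCommGroup X] [Module A X] [Module Aᵐᵒᵖ X]
    [AddCommGroup Y] [Module A Y] [Module Aᵐᵒᵖ Y] (RX : RingOn X) (RY : RingOn Y)
    (f : BimodHom A X Y) (E : BimodHom A Y X) : Prop where
  map_mul : ∀ x y, f (RX.mul x y) = RY.mul (f x) (f y)
  map_one : f RX.one = RY.one
  mul_left : ∀ x y, E (RY.mul (f x) y) = RX.mul x (E y)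
  mul_right : ∀ x y, E (RY.mul y (f x)) = RX.mul (E y) x
  exists_dual : ∃ (κ : Type) (_ : Fintype κ) (u v : κ → Y),
    (∀ b, ∑ i, RY.mul (u i) (f (E (RY.mul (v i) b))) = b) ∧
    (∀ b, ∑ i, RY.mul (f (E (RY.mul b (u i)))) (v i) = b)

namespace Coring.FrobeniusSystem

variable {A C : Type u} [Ring A] [AddCommGroup C] [Module A C] [Module Aᵐᵒᵖ C]
  [SMulCommClass A Aᵐᵒᵖ C] {𝒞 : Coring A C} (S : 𝒞.FrobeniusSystem)

/-- The ring `Z` is the ring `C ⊗ X ⊗ C`, where `τ c x c'` is `c ⊗ x ⊗ c'`. -/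
structure IsTriple {X Z : Type u} [AddCommGroup X] [Module A X] [Module Aᵐᵒᵖ X] [AddCommGroup Z]
    (R : RingOn X) (Q : RingOn Z) {ι : Type} [Fintype ι] (x z : ι → C)
    (τ : C →+ X →+ C →+ Z) : Prop where
  op_smul_left : ∀ c (a : A) w c', τ (op a • c) w c' = τ c (a • w) c'
  op_smul_right : ∀ c (a : A) w c', τ c (op a • w) c' = τ c w (a • c')
  inductionOn : ∀ {p : Z → Prop} (t : Z), (∀ c w c', p (τ c w c')) →
    (∀ s t, p s → p t → p (s + t)) → p t
  mul : ∀ c c' d d' w y,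
    Q.mul (τ c w c') (τ d y d') = τ c (R.mul w (S.γ (tmul A c' d) • y)) d'
  one : Q.one = ∑ j, τ (x j) R.one (z j)

theorem IsTriple.induction_on {X Z : Type u} [AddCommGroup X] [Module A X] [Module Aᵐᵒᵖ X]
    [AddCommGroup Z] {S : 𝒞.FrobeniusSystem} {R : RingOn X} {Q : RingOn Z} {ι : Type} [Fintype ι]
    {x z : ι → C} {τ : C →+ X →+ C →+ Z} (hX : S.IsTriple R Q x z τ) {p : Z → Prop} (t : Z)
    (h : ∀ c w c', p (τ c w c')) (hadd : ∀ s t, p s → p t → p (s + t)) : p t :=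
  hX.inductionOn t h hadd

/-- Every element of `Y` is a combination of elements `y γ(p ⊗ q)`. -/
def IsFull (Y : Type u) [AddCommGroup Y] [Module Aᵐᵒᵖ Y] : Prop :=
  ∀ y : Y, ∃ (ρ : Type) (_ : Fintype ρ) (w : ρ → Y) (p q : ρ → C),
    ∑ r, op (S.γ (tmul A (p r) (q r))) • w r = y

variable {S} {X Y Z W : Type u} [AddCommGroup X] [Module A X] [Module Aᵐᵒᵖ X]
  [AddCommGroup Y] [Module A Y] [Module Aᵐᵒᵖ Y] [SMulCommClass A Aᵐᵒᵖ Y]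
  [AddCommGroup Z] [Module A Z] [Module Aᵐᵒᵖ Z] [AddCommGroup W] [Module A W] [Module Aᵐᵒᵖ W]
  {RX : RingOn X} {RY : RingOn Y} {RZ : RingOn Z} {RW : RingOn W}
  {ι : Type} [Fintype ι] {x z : ι → C} {τ : C →+ X →+ C →+ Z} {σ : C →+ Y →+ C →+ W}
  {f : BimodHom A X Y} {E : BimodHom A Y X} {F : BimodHom A Z W} {G : BimodHom A W Z}

/-- Dual bases `u_i, v_i` for `E` cannot simply be flanked by the legs of `Δ(e)`: a product inserts
a factor `γ(p ⊗ q)` between `u_i` and `v_i`. Fullness removes the obstacle. Write `u_i = ∑ w_ir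
γ(p_ir ⊗ q_ir)` and take `x_j ⊗ w_ir ⊗ p_ir` and `q_ir ⊗ v_i ⊗ z_j`. -/
theorem IsTriple.exists_dual (h : S.IsCasimir x z) (hRY : RY.IsBalanced A)
    (hY : S.IsTriple RY RW x z σ)
    (hp : IsFrobeniusPair RX RY f E) (hfull : S.IsFull Y)
    (hF : ∀ c w c', F (τ c w c') = σ c (f w) c') (hG : ∀ c y c', G (σ c y c') = τ c (E y) c') :
    ∃ (κ : Type) (_ : Fintype κ) (u v : κ → W),
      (∀ b, ∑ i, RW.mul (u i) (F (G (RW.mul (v i) b))) = b) ∧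
      (∀ b, ∑ i, RW.mul (F (G (RW.mul b (u i)))) (v i) = b) := by
  obtain ⟨κ, _, u, v, huv, hvu⟩ := hp.exists_dual
  choose ρ hρ w p q hw using fun i => hfull (u i)
  have hfE : ∀ (a : A) (y : Y), f (E (op a • y)) = op a • f (E y) := fun a y =>
    (congrArg f (E.map_op_smul' a y)).trans (f.map_op_smul' a (E y))
  refine ⟨ι × Σ i, ρ i, inferInstance, fun k => σ (x k.1) (w k.2.1 k.2.2) (p k.2.1 k.2.2),
    fun k => σ (q k.2.1 k.2.2) (v k.2.1) (z k.1), fun b => ?_, fun b => ?_⟩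
  · induction b using hY.induction_on with
    | h c y c' =>
      simp only [hY.mul, hG, hF, Fintype.sum_prod_type, Fintype.sum_sigma]
      -- Three sums collapse in turn: over `r` to recover `u_i`, over `i` by duality for `E`, over
      -- `j` by the dual basis identity for `γ`, which restores `c`.
      have h1 : ∀ j i, ∑ r, σ (x j) (RY.mul (w i r) (S.γ (tmul A (p i r) (q i r)) •
          f (E (RY.mul (v i) (S.γ (tmul A (z j) c) • y))))) c' =
          σ (x j) (RY.mul (u i) (f (E (RY.mul (v i) (S.γ (tmul A (z j) c) • y))))) c' := by
        intro j i
        conv_rhs => rw [← hw i, RY.sum_mul]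
        simp only [map_sum, AddMonoidHom.finsetSum_apply, hRY.op_smul_mul]
      have h2 : ∀ j, ∑ i, σ (x j) (RY.mul (u i) (f (E (RY.mul (v i)
          (S.γ (tmul A (z j) c) • y))))) c' = σ (op (S.γ (tmul A (z j) c)) • x j) y c' := by
        intro j
        rw [hY.op_smul_left]
        conv_rhs => rw [← huv (S.γ (tmul A (z j) c) • y)]
        simp only [map_sum, AddMonoidHom.finsetSum_apply]
      simp only [h1, h2]
      conv_rhs => rw [← h.sum_op_smul c]
      simp only [map_sum, AddMonoidHom.finsetSum_apply]
    | hadd s t hs ht =>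
      simp only [RW.left_distrib, map_add, Finset.sum_add_distrib]
      exact congrArg₂ (· + ·) hs ht
  · induction b using hY.induction_on with
    | h c y c' =>
      simp only [hY.mul, hG, hF, Fintype.sum_prod_type, Fintype.sum_sigma]
      -- Here `γ(p ⊗ q)` stands outside `f(E(-))`; right linearity of `f ∘ E` brings it inside, next
      -- to `w_ir`.
      have h1 : ∀ j i, ∑ r, σ c (RY.mul (f (E (RY.mul y (S.γ (tmul A c' (x j)) • w i r))))
          (S.γ (tmul A (p i r) (q i r)) • v i)) (z j) =
          σ c (RY.mul (f (E (RY.mul (op (S.γ (tmul A c' (x j))) • y) (u i)))) (v i)) (z j) := by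
        intro j i
        conv_rhs => rw [← hw i, RY.mul_sum]
        simp only [map_sum, RY.sum_mul, AddMonoidHom.finsetSum_apply, hRY.op_smul_mul,
          hRY.mul_op_smul, hfE, smul_comm _ (op _)]
      have h2 : ∀ j, ∑ i, σ c (RY.mul (f (E (RY.mul (op (S.γ (tmul A c' (x j))) • y) (u i))))
          (v i)) (z j) = σ c y (S.γ (tmul A c' (x j)) • z j) := by
        intro j
        rw [← hY.op_smul_right]
        conv_rhs => rw [← hvu (op (S.γ (tmul A c' (x j))) • y)]
        simp only [map_sum, AddMonoidHom.finsetSum_apply]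
      simp only [h1, h2]
      conv_rhs => rw [← h.sum_smul c']
      simp only [map_sum]
    | hadd s t hs ht =>
      simp only [RW.right_distrib, map_add, Finset.sum_add_distrib]
      exact congrArg₂ (· + ·) hs ht

/-- If `X → Y` is Frobenius, then so is `C ⊗ X ⊗ C → C ⊗ Y ⊗ C`. -/
theorem IsTriple.isFrobeniusPair (h : S.IsCasimir x z) (hRY : RY.IsBalanced A)
    (hX : S.IsTriple RX RZ x z τ) (hY : S.IsTriple RY RW x z σ)
    (hp : IsFrobeniusPair RX RY f E) (hfull : S.IsFull Y)
    (hF : ∀ c w c', F (τ c w c') = σ c (f w) c') (hG : ∀ c y c', G (σ c y c') = τ c (E y) c') :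
    IsFrobeniusPair RZ RW F G where
  map_mul s t := by
    induction s using hX.induction_on with
    | h c w c' =>
      induction t using hX.induction_on with
      | h d y d' =>
        have h1 : ∀ (a : A) y, f (a • y) = a • f y := f.map_smul'
        simp only [hX.mul, hY.mul, hF, hp.map_mul, h1]
      | hadd t t' ht ht' =>
        rw [RZ.left_distrib, map_add, map_add, RW.left_distrib, ht, ht']
    | hadd s s' hs hs' =>
      rw [RZ.right_distrib, map_add, map_add, RW.right_distrib, hs, hs']
  map_one := by
    rw [hX.one, hY.one, map_sum]
    simp only [hF, hp.map_one]
  mul_left s t := by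
    induction s using hX.induction_on with
    | h c w c' =>
      induction t using hY.induction_on with
      | h d y d' =>
        have h1 : ∀ (a : A) y, E (a • y) = a • E y := E.map_smul'
        simp only [hX.mul, hY.mul, hF, hG, hp.mul_left, h1]
      | hadd t t' ht ht' =>
        rw [RW.left_distrib, map_add, map_add, RZ.left_distrib, ht, ht']
    | hadd s s' hs hs' =>
      rw [RZ.right_distrib, map_add, RW.right_distrib, map_add, hs, hs']
  mul_right s t := by
    induction s using hX.induction_on with
    | h c w c' =>
      induction t using hY.induction_on with
      | h d y d' =>
        have h1 : ∀ (a : A) y, f (a • y) = a • f y := f.map_smul'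
        simp only [hX.mul, hY.mul, hF, hG, ← h1, hp.mul_right]
      | hadd t t' ht ht' =>
        rw [RW.right_distrib, map_add, map_add, RZ.right_distrib, ht, ht']
    | hadd s s' hs hs' =>
      rw [RZ.left_distrib, map_add, RW.left_distrib, map_add, hs, hs']
  exists_dual := IsTriple.exists_dual h hRY hY hp hfull hF hG

/-- The last tensor factor provides the coefficients, since `c' = ∑ x_j γ(z_j ⊗ c')`. -/
theorem IsTriple.isFull (h : S.IsCasimir x z)
    (hX : S.IsTriple RX RZ x z τ) (hτ : ∀ c w c' (a : A), τ c w (op a • c') = op a • τ c w c') :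
    S.IsFull Z := by
  intro t
  induction t using hX.induction_on with
  | h c w c' =>
    refine ⟨ι, inferInstance, fun j => τ c w (x j), z, fun _ => c', ?_⟩
    simp only [← hτ, ← map_sum, h.sum_op_smul]
  | hadd s t hs ht =>
    obtain ⟨ρ, _, w, p, q, rfl⟩ := hs
    obtain ⟨ρ', _, w', p', q', rfl⟩ := ht
    exact ⟨ρ ⊕ ρ', inferInstance, Sum.elim w w', Sum.elim p p', Sum.elim q q', by simp⟩

theorem IsCasimir.isFull (h : S.IsCasimir x z) : S.IsFull C := fun c =>
  ⟨ι, inferInstance, x, z, fun _ => c, h.sum_op_smul c⟩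

theorem tripleRing_isTriple [SMulCommClass A Aᵐᵒᵖ X] (h : S.IsCasimir x z)
    (hR : RX.IsBalanced A) : S.IsTriple RX (tripleRing h hR) x z (mk₃ A C X) where
  op_smul_left c a w c' := by simp only [mk₃_apply, smul_tmul, smul_tmul']
  op_smul_right c a w c' := by simp only [mk₃_apply, smul_tmul]
  inductionOn := induction_on_triple
  mul c c' d d' w y := rfl
  one := rfl

end Coring.FrobeniusSystem

/-! ### The two lowest levels, and the induction along the tower. -/

namespace Coring.FrobeniusSystem

variable {A C : Type u} [Ring A] [AddCommGroup C] [Module A C] [Module Aᵐᵒᵖ C]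
  [SMulCommClass A Aᵐᵒᵖ C] {𝒞 : Coring A C} {S : 𝒞.FrobeniusSystem}

theorem IsTriple.transport {X Z W : Type u} [AddCommGroup X] [Module A X] [Module Aᵐᵒᵖ X]
    [AddCommGroup Z] [AddCommGroup W] {R : RingOn X} {Q : RingOn Z} {ι : Type} [Fintype ι]
    {x z : ι → C} {τ : C →+ X →+ C →+ Z} (hX : S.IsTriple R Q x z τ) (φ : W ≃+ Z)
    (σ : C →+ X →+ C →+ W) (hσ : ∀ c w c', φ (σ c w c') = τ c w c') :
    S.IsTriple R (Q.transport φ) x z σ where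
  op_smul_left c a w c' := φ.injective (by simp only [hσ, hX.op_smul_left])
  op_smul_right c a w c' := φ.injective (by simp only [hσ, hX.op_smul_right])
  inductionOn {p} t h hadd := by
    obtain ⟨t, rfl⟩ := φ.symm.surjective t
    induction t using hX.induction_on with
    | h c w c' =>
      rw [← hσ, AddEquiv.symm_apply_apply]
      exact h c w c'
    | hadd s t hs ht =>
      rw [map_add]
      exact hadd _ _ hs ht
  mul c c' d d' w y := φ.injective (by simp [RingOn.transport, hσ, hX.mul])
  one := φ.injective (by simp only [RingOn.transport, hX.one, map_sum, hσ,
    AddEquiv.apply_symm_apply])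

variable (A C) in
/-- The isomorphism `C ⊗ C ≃ C ⊗ (A ⊗ C)`. -/
def insertBase : Tensor A C C ≃+ Tensor A C (Tensor A A C) :=
  AddMonoidHom.toAddEquiv
    (BimodHom.tensor (BimodHom.id A C) (BimodHom.lidInv A C)).toAddMonoidHom
    (BimodHom.tensor (BimodHom.id A C) (BimodHom.lid A C)).toAddMonoidHom
    (addHom_ext fun c d => congrArg (tmul A c) (one_smul A d))
    (addHom_ext fun c t => by
      induction t using Tensor.induction_on with
      | h a d =>
        change tmul A c (tmul A 1 (a • d)) = tmul A c (tmul A a d)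
        rw [← smul_tmul]
        simp
      | hadd x y hx hy => rw [tmul_add, map_add, map_add, hx, hy])

theorem insertBase_tmul (c d : C) : insertBase A C (tmul A c d) = tmul A c (tmul A 1 d) := rfl

theorem insertBase_smul (a : A) (t : Tensor A C C) :
    insertBase A C (a • t) = a • insertBase A C t :=
  (BimodHom.tensor (BimodHom.id A C) (BimodHom.lidInv A C)).map_smul' a t

theorem insertBase_op_smul (a : A) (t : Tensor A C C) :
    insertBase A C (op a • t) = op a • insertBase A C t :=
  (BimodHom.tensor (BimodHom.id A C) (BimodHom.lidInv A C)).map_op_smul' a t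

variable (A C) in
/-- The triadditive map `(c, a, c') ↦ c ⊗ a c'`. -/
def mkBase : C →+ A →+ C →+ Tensor A C C :=
  AddMonoidHom.mk' (fun c => (Tensor.mk A c).compHom.comp (smulAddHom A C)) (fun c d => by
    ext a c'
    exact add_tmul A c d (a • c'))

theorem mkBase_apply (c : C) (a : A) (c' : C) : mkBase A C c a c' = tmul A c (a • c') := rfl

theorem insertBase_mkBase (c : C) (a : A) (c' : C) :
    insertBase A C (mkBase A C c a c') = mk₃ A C A c a c' := by
  rw [mkBase_apply, insertBase_tmul, mk₃_apply, ← smul_tmul]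
  simp

variable (A) in
/-- The multiplication of `A`. -/
def baseRing : RingOn A where
  mul a b := a * b
  one := 1
  mul_assoc := mul_assoc
  one_mul := one_mul
  mul_one := mul_one
  left_distrib := mul_add
  right_distrib := add_mul

theorem baseRing_isBalanced : (baseRing A).IsBalanced A where
  smul_mul := mul_assoc
  mul_op_smul a x y := (mul_assoc x y a).symm
  op_smul_mul a x y := mul_assoc x a y

variable (S) in
/-- The multiplication `c d = π (c ⊗ d)`. -/
def coringRing : RingOn C where
  mul c d := S.π (tmul A c d)
  one := S.e
  mul_assoc := S.π_assoc
  one_mul := S.π_e_tmul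
  mul_one := S.π_tmul_e
  left_distrib c d d' := by rw [tmul_add, map_add]
  right_distrib c c' d := by rw [add_tmul, map_add]

theorem coringRing_isBalanced : S.coringRing.IsBalanced A where
  smul_mul a c d := S.π.map_smul' a (tmul A c d)
  mul_op_smul a c d := S.π.map_op_smul' a (tmul A c d)
  op_smul_mul a c d := congrArg S.π (smul_tmul A c a d)

section Tower

variable {ι : Type} [Fintype ι] {x z : ι → C} (h : S.IsCasimir x z)

theorem π_smul (a : A) (c d : C) : S.π (tmul A (a • c) d) = a • S.π (tmul A c d) :=
  S.π.map_smul' a (tmul A c d)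

theorem π_op_smul (a : A) (c d : C) : S.π (tmul A c (op a • d)) = op a • S.π (tmul A c d) :=
  S.π.map_op_smul' a (tmul A c d)

theorem IsCasimir.sum_π_tmul_Θ (h : S.IsCasimir x z) (b : C) :
    ∑ i, S.π (tmul A (x i) (S.Θ (S.γ (tmul A (z i) b)))) = b := by
  change ∑ i, S.π (tmul A (x i) (S.γ (tmul A (z i) b) • S.e)) = b
  simp only [S.invariant, π_op_smul, S.π_tmul_e, h.sum_op_smul]

theorem IsCasimir.sum_π_Θ_tmul (h : S.IsCasimir x z) (b : C) :
    ∑ i, S.π (tmul A (S.Θ (S.γ (tmul A b (x i)))) (z i)) = b := by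
  change ∑ i, S.π (tmul A (S.γ (tmul A b (x i)) • S.e) (z i)) = b
  simp only [π_smul, S.π_e_tmul, h.sum_smul]

/-- Right colinearity at `c ⊗ e`: the coproduct is `c ↦ c Δ(e)`. This later identifies the lowest
coring of the tower with the given one. -/
theorem IsCasimir.comul_eq (h : S.IsCasimir x z) (c : C) :
    𝒞.comul c = ∑ i, tmul A (S.π (tmul A c (x i))) (z i) := by
  conv_lhs => rw [← S.π_tmul_e c, S.right_colinear, map_tmul, BimodHom.left_apply, h]
  simp [tmul_sum]

/-- Since `γ(c ⊗ d) = ε(c d)`, the legs of `Δ(e)` are dual bases for `ε`. -/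
theorem isFrobeniusPair_zero (h : S.IsCasimir x z) :
    IsFrobeniusPair (baseRing A) S.coringRing S.Θ 𝒞.counit where
  map_mul a b := by
    change (a * b) • S.e = S.π (tmul A (a • S.e) (b • S.e))
    rw [π_smul, S.π_e_tmul, mul_smul]
  map_one := one_smul A S.e
  mul_left a c := by
    change 𝒞.counit (S.π (tmul A (a • S.e) c)) = a * 𝒞.counit c
    rw [π_smul, S.π_e_tmul]
    exact 𝒞.counit.map_smul' a c
  mul_right a c := by
    change 𝒞.counit (S.π (tmul A c (a • S.e))) = 𝒞.counit c * a
    rw [S.invariant, π_op_smul, S.π_tmul_e]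
    exact 𝒞.counit.map_op_smul' a c
  exists_dual := by
    exact ⟨ι, inferInstance, x, z, h.sum_π_tmul_Θ, h.sum_π_Θ_tmul⟩

/-- The ring structure on `C ⊗ C`. -/
def squareRing (h : S.IsCasimir x z) : RingOn (Tensor A C C) :=
  (tripleRing h baseRing_isBalanced).transport (insertBase A C)

theorem squareRing_mul (c c' d d' : C) :
    (squareRing h).mul (tmul A c c') (tmul A d d') = tmul A c (S.γ (tmul A c' d) • d') := by
  change tmul A c (((1 : A) * (S.γ (tmul A c' d) * 1)) • d') = _
  rw [one_mul, mul_one]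

/-- By `π_eq_lid`. With `squareRing_comul_mul` it shows that, along `Δ`, the ring `C` acts on `C ⊗
C` by multiplying the outer factors. -/
theorem squareRing_mul_comul (p q d : C) :
    (squareRing h).mul (tmul A p q) (𝒞.comul d) = tmul A p (S.π (tmul A q d)) := by
  rw [S.π_eq_lid]
  induction 𝒞.comul d using Tensor.induction_on with
  | h a b => simp [squareRing_mul]
  | hadd x y hx hy => simp only [(squareRing h).left_distrib, tmul_add, map_add, hx, hy]

theorem squareRing_comul_mul (c p q : C) :
    (squareRing h).mul (𝒞.comul c) (tmul A p q) = tmul A (S.π (tmul A c p)) q := by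
  rw [S.π_eq_rid]
  induction 𝒞.comul c using Tensor.induction_on with
  | h a b => simp [squareRing_mul, smul_tmul]
  | hadd x y hx hy =>
    simp only [(squareRing h).right_distrib, add_tmul, map_add, hx, hy]

theorem isFrobeniusPair_one (h : S.IsCasimir x z) :
    IsFrobeniusPair S.coringRing (squareRing h) 𝒞.comul S.π where
  map_mul c d := by
    change 𝒞.comul (S.π (tmul A c d)) = _
    rw [S.left_colinear, map_tmul, BimodHom.right_apply, LinearMap.id_apply]
    induction 𝒞.comul c using Tensor.induction_on with
    | h a b => simp [squareRing_mul_comul]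
    | hadd x y hx hy => simp only [(squareRing h).right_distrib, add_tmul, map_add, hx, hy]
  map_one := by
    refine Eq.trans h ?_
    change _ = (insertBase A C).symm (∑ j, mk₃ A C A (x j) 1 (z j))
    simp only [map_sum, ← insertBase_mkBase, AddEquiv.symm_apply_apply, mkBase_apply, one_smul]
  mul_left c t := by
    change _ = S.π (tmul A c (S.π t))
    induction t using Tensor.induction_on with
    | h p q => rw [squareRing_comul_mul, S.π_assoc]
    | hadd x y hx hy => simp only [(squareRing h).left_distrib, tmul_add, map_add, hx, hy]
  mul_right c t := by
    change _ = S.π (tmul A (S.π t) c)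
    induction t using Tensor.induction_on with
    | h p q => rw [squareRing_mul_comul, S.π_assoc]
    | hadd x y hx hy => simp only [(squareRing h).right_distrib, add_tmul, map_add, hx, hy]
  exists_dual := by
    -- Padding the legs of `Δ(e)` with `e` works because `π` removes the `e` and leaves the
    -- coefficients `γ(z_j ⊗ c)` and `γ(c' ⊗ x_j)`.
    refine ⟨ι, inferInstance, fun j => tmul A (x j) S.e, fun j => tmul A S.e (z j), fun b => ?_,
      fun b => ?_⟩
    · induction b using Tensor.induction_on with
      | h c c' =>
        simp only [squareRing_mul, S.π_e_tmul, squareRing_mul_comul]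
        simp only [← smul_tmul, ← sum_tmul, h.sum_op_smul]
      | hadd s t hs ht =>
        simp only [(squareRing h).left_distrib, map_add, Finset.sum_add_distrib, hs, ht]
    · induction b using Tensor.induction_on with
      | h c c' =>
        simp only [squareRing_mul, ← smul_tmul, S.π_tmul_e, squareRing_comul_mul]
        simp only [smul_tmul, ← tmul_sum, h.sum_smul]
      | hadd s t hs ht =>
        simp only [(squareRing h).right_distrib, map_add, Finset.sum_add_distrib, hs, ht]

/-- The rings of the tower. -/
def towerRing (h : S.IsCasimir x z) : ∀ k : ℕ, {R : RingOn (TPow A C k) // R.IsBalanced A}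
  | 0 => ⟨baseRing A, baseRing_isBalanced (A := A)⟩
  | 1 => ⟨S.coringRing, coringRing_isBalanced (C := C)⟩
  | 2 => ⟨squareRing h,
      (tripleRing_isBalanced baseRing_isBalanced h).transport _ insertBase_smul
        insertBase_op_smul⟩
  | k + 3 => ⟨tripleRing h (towerRing h (k + 1)).2,
      tripleRing_isBalanced (towerRing h (k + 1)).2 h⟩

variable (A C) in
/-- The map `(c, x, c') ↦ c ⊗ x ⊗ c'` from `C × Cᵏ × C` to `Cᵏ⁺²`. -/
def towerMk : ∀ k : ℕ, C →+ TPow A C k →+ C →+ TPow A C (k + 2)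
  | 0 => mkBase A C
  | k + 1 => mk₃ A C (TPow A C (k + 1))

theorem towerMk_isTriple : ∀ k : ℕ,
    S.IsTriple (towerRing h k).1 (towerRing h (k + 2)).1 x z (towerMk A C k)
  | 0 => (tripleRing_isTriple h baseRing_isBalanced).transport _ _ insertBase_mkBase
  | k + 1 => tripleRing_isTriple h (towerRing h (k + 1)).2

theorem towerMk_op_smul (k : ℕ) (c : C) (w : TPow A C k) (c' : C) (a : A) :
    towerMk A C k c w (op a • c') = op a • towerMk A C k c w c' := by
  cases k with
  | zero => exact congrArg (tmul A c) (smul_comm (show A from w) (op a) c')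
  | succ k => rfl

theorem IsCasimir.isFull_tpow (h : S.IsCasimir x z) (k : ℕ) : S.IsFull (TPow A C (k + 1)) := by
  cases k with
  | zero => exact h.isFull
  | succ k => exact (towerMk_isTriple h k).isFull h (towerMk_op_smul k)

theorem up_towerMk (k : ℕ) (c : C) (w : TPow A C k) (c' : C) :
    S.up (k + 2) (towerMk A C k c w c') = towerMk A C (k + 1) c (S.up k w) c' := by
  cases k with
  | zero =>
    let a : A := w
    -- Here `C ⊗ C` stands for `C ⊗ A ⊗ C`; invariance of `e` moves `a` from the right of `e` to its
    -- left.
    change tmul A c (tmul A ((1 : A) • S.e) (a • c')) = tmul A c (tmul A (a • S.e) c')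
    rw [one_smul, ← smul_tmul, ← S.invariant]
  | succ k => rfl

theorem down_towerMk (k : ℕ) (c : C) (w : TPow A C (k + 1)) (c' : C) :
    S.down (k + 2) (towerMk A C (k + 1) c w c') = towerMk A C k c (S.down k w) c' := by
  cases k with
  | zero => rfl
  | succ k => rfl

/-- The inductive step adds a factor `C` at both ends, so the level rises by two and two base cases
are needed. Fullness is used only for the target `C^(k+1)`, never for `A`. -/
theorem isFrobeniusPair_tower : ∀ k : ℕ,
    IsFrobeniusPair (towerRing h k).1 (towerRing h (k + 1)).1 (S.up k) (S.down k)
  | 0 => isFrobeniusPair_zero h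
  | 1 => isFrobeniusPair_one h
  | k + 2 => IsTriple.isFrobeniusPair h (towerRing h (k + 1)).2 (towerMk_isTriple h k)
      (towerMk_isTriple h (k + 1)) (isFrobeniusPair_tower k) (h.isFull_tpow k) (up_towerMk k)
      (down_towerMk k)

theorem towerRing_isTowerMul : S.IsTowerMul fun k => (towerRing h k).1 where
  mul_zero _ _ := rfl
  one_zero := rfl
  mul_one _ _ := rfl
  mul_two := squareRing_mul h
  mul_add_three _ _ _ _ _ _ _ := rfl

end Tower

end Coring.FrobeniusSystem

/-! ### From Frobenius pairs to ring maps, and the theorem. -/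

namespace IsFrobeniusPair

variable {A X Y : Type u} [Ring A] [AddCommGroup X] [Module A X] [Module Aᵐᵒᵖ X]
  [AddCommGroup Y] [Module A Y] [Module Aᵐᵒᵖ Y] {RX : RingOn X} {RY : RingOn Y}
  {f : BimodHom A X Y} {E : BimodHom A Y X} (h : IsFrobeniusPair RX RY f E)

/-- The ring map of a Frobenius pair. -/
def ringHom (h : IsFrobeniusPair RX RY f E) : RX.Carrier →+* RY.Carrier where
  toFun := f
  map_one' := h.map_one
  map_mul' := h.map_mul
  map_zero' := map_zero f
  map_add' := map_add f

/-- The bimodule map of a Frobenius pair in the opposite direction. -/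
def counit : BimodHom RX.Carrier (Along h.ringHom) RX.Carrier where
  toFun := E
  map_zero' := map_zero E
  map_add' := map_add E
  map_smul' := h.mul_left
  map_op_smul' := h.mul_right

theorem exists_isDualBasis : ∃ (κ : Type) (_ : Fintype κ) (u v : κ → Along h.ringHom),
    IsDualBasis h.counit u v := by
  obtain ⟨κ, _, u, v, huv, hvu⟩ := h.exists_dual
  exact ⟨κ, inferInstance, u, v, huv, hvu⟩

end IsFrobeniusPair

end CoringTower

theorem theorem3p2 {A C : Type u} [Ring A] [AddCommGroup C] [Module A C] [Module Aᵐᵒᵖ C]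
    [SMulCommClass A Aᵐᵒᵖ C] (𝒞 : Coring A C) (h𝒞 : 𝒞.IsFrobenius) :
    Nonempty 𝒞.FrobeniusSystem ∧
    ∀ S : 𝒞.FrobeniusSystem,
      ∃ R : ∀ k : ℕ, RingOn (TPow A C k),
        S.IsTowerMul R ∧
        ∃ f : ∀ k : ℕ, (R k).Carrier →+* (R (k + 1)).Carrier,
          (∀ (k : ℕ) (x : TPow A C k), f k x = S.up k x) ∧
          (∀ k : ℕ, IsFrobeniusExtension (f k)) ∧
          ∃ D : ∀ k : ℕ, Coring (R k).Carrier (Along (f k)),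
            (∀ k : ℕ, (D k).IsFrobenius) ∧
            (∀ (k : ℕ) (x : TPow A C (k + 1)), (D k).counit x = S.down k x) ∧
            (∀ k : ℕ, ∃ T : (D k).FrobeniusSystem,
              T.e = 1 ∧ ∀ x y, T.π (Tensor.tmul _ x y) = x * y) ∧
            ∃ (α : A ≃+* (R 0).Carrier) (φ : C ≃+ Along (f 0)),
              (∀ a : A, α a = a) ∧ (∀ c : C, φ c = c) ∧ 𝒞.IsIsoOver (D 0) α φ := by
  refine ⟨h𝒞.nonempty_frobeniusSystem, fun S => ?_⟩
  obtain ⟨ι, _, x, z, h⟩ := Tensor.exists_eq_sum (𝒞.comul S.e)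
  replace h : S.IsCasimir x z := h
  have hp := Coring.FrobeniusSystem.isFrobeniusPair_tower h
  choose κ hκ u v huv using fun k => (hp k).exists_isDualBasis
  refine ⟨fun k => (Coring.FrobeniusSystem.towerRing h k).1,
    Coring.FrobeniusSystem.towerRing_isTowerMul h, fun k => (hp k).ringHom, fun _ _ => rfl,
    fun k => (huv k).isFrobeniusExtension, fun k => (huv k).coring,
    fun k => (huv k).frobeniusSystem.isFrobenius, fun _ _ => rfl,
    fun k => ⟨(huv k).frobeniusSystem, rfl, fun _ _ => rfl⟩, ?_⟩
  let α : A ≃+* (Coring.FrobeniusSystem.towerRing h 0).1.Carrier :=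
    { toFun := fun a => a
      invFun := fun a => a
      left_inv := fun _ => rfl
      right_inv := fun _ => rfl
      map_add' := fun _ _ => rfl
      map_mul' := fun _ _ => rfl }
  let φ : C ≃+ Along (hp 0).ringHom :=
    { toFun := fun a => a
      invFun := fun a => a
      left_inv := fun _ => rfl
      right_inv := fun _ => rfl
      map_add' := fun _ _ => rfl }
  have hsmul : ∀ (a : A) c, φ (a • c) = α a • φ c := by
    intro a c
    -- The action of `A` through `Θ` is multiplication by `a e`, and this is the original action
    -- because `e` is the unit.
    change a • c = S.π (Tensor.tmul A (a • S.e) c)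
    rw [Coring.FrobeniusSystem.π_smul, S.π_e_tmul]
  have hop : ∀ (a : A) c, φ (op a • c) = op (α a) • φ c := by
    intro a c
    change op a • c = S.π (Tensor.tmul A c (a • S.e))
    rw [S.invariant, Coring.FrobeniusSystem.π_op_smul, S.π_tmul_e]
  refine ⟨α, φ, fun _ => rfl, fun _ => rfl, hsmul, hop, fun _ => rfl,
    Tensor.lift A (((Tensor.mk _).comp φ.toAddMonoidHom).compl₂ φ.toAddMonoidHom)
      (fun c a d => ?_), fun _ _ => rfl, fun c => ?_⟩
  · change Tensor.tmul _ (φ (op a • c)) (φ d) = Tensor.tmul _ (φ c) (φ (a • d))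
    rw [hop, hsmul, Tensor.smul_tmul]
  -- The coproduct of `D 0` was built from arbitrarily chosen dual bases, while `Δ` comes from the
  -- legs of `Δ(e)`. Both families are dual for `ε`, and the tensor they define does not depend on
  -- the choice.
  · have hxz : IsDualBasis (hp 0).counit (fun i => φ (x i)) (fun i => φ (z i)) :=
      ⟨h.sum_π_tmul_Θ, h.sum_π_Θ_tmul⟩
    have h1 := (huv 0).sum_tmul_eq hxz (φ c) 1
    simp only [mul_one] at h1
    refine h1.trans ?_
    rw [h.comul_eq c, map_sum]
    rfl
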